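/- Let $p$ be a prime and let $(R,\mathfrak m,k)$ be a noetherian local domain of characteristic $p$ that is $F$-finite (i.e. its Frobenius endomorphism is finite). For an $R$-module $M$ and $e\ge 0$ let $F^e_*M$ denote $M$ with $R$ acting through the $e$-th iterated Frobenius, $r\cdot F^e_*m=F^e_*(r^{p^e}m)$. Let $\mathcal C=\bigoplus_e \mathcal C_e$ be a Cartier subalgebra of $\mathcal C_R=\bigoplus_{e\ge 0}\operatorname{Hom}_R(F^e_*R,R)$; that is, each $\mathcal C_e\subseteq \operatorname{Hom}_R(F^e_*R,R)$ is an $R$-submodule (for post-multiplication), $\mathcal C_0=\operatorname{Hom}_R(R,R)=R$, and $\varphi\circ F^d_*\psi\in\mathcal C_{d+e}$ for all $\varphi\in\mathcal C_d$, $\psi\in\mathcal C_e$. For a finite $R$-module $M$ and a graded left $\mathcal C$-submodule $\mathcal M=\bigoplus_e\mathcal M_e$ of $M^\flat=\bigoplus_e \operatorname{Hom}_R(F^e_*M,R)$ (with $\mathcal C$ acting by $\varphi\cdot\vartheta=\varphi\circ F^d_*\vartheta$ for $\varphi\in\mathcal C_d$), put $$a_e(\mathcal M)=\operatorname{length}_R\bigl(\mathcal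 M_e/(\mathcal M_e\cap \operatorname{Hom}_R(F^e_*M,\mathfrak m))\bigr),\quad n_{\mathcal M}=\gcd\{e\mid a_e(\mathcal M)\ne 0\},\quad \delta=\dim R+\log_p[k^{1/p}:k].$$ The splitting ratio of $\mathcal M$ is $$\operatorname{asr}(\mathcal M)=\lim_{e\to\infty}\frac{a_{e n_{\mathcal M}}(\mathcal M)}{p^{\,e n_{\mathcal M}\delta}}\ \text{ if } n_{\mathcal M}\neq 0,$$ and $\operatorname{asr}(\mathcal M)=0$ if $n_{\mathcal M}=0$, i.e. if $a_e(\mathcal M)=0$ for all $e>0$. The $F$-signature of $(R,\mathcal C)$ is $s(R,\mathcal C)=\operatorname{asr}(\mathcal C)$, where $\mathcal C\subseteq R^\flat=\mathcal C_R$ is viewed as a graded left module over itself. Finally, let $M^\natural\subseteq M^\flat$ be the graded left $\mathcal C$-submodule whose degree-$e$ part is the additive subgroup of $\operatorname{Hom}_R(F^e_*M,R)$ generated by the maps $\varphi\circ F^e_*\rho$ with $\varphi\in\mathcal C_e$ and $\rho\in M^\vee=\operatorname{Hom}_R(M,R)$. Theorem. For every finite $R$-module $M$, the limits defining $s(R,\mathcal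 C)$ and $\operatorname{asr}(M^\natural)$ exist, and $$\operatorname{asr}(M^\natural)=\operatorname{rank} M\cdot s(R,\mathcal C).$$ -/

import Mathlib

set_option maxSynthPendingDepth 3

open Filter Topology

noncomputable section

/-- The Frobenius pushforward `F^e_* M`: the abelian group `M`, on which a ring `R` of
characteristic `p` acts through the `e`-th iterate of its Frobenius endomorphism. -/
def FrobPush (_p _e : ℕ) (M : Type*) : Type _ := M

namespace FrobPush

variable (p e d : ℕ) {R M N : Type*} [CommRing R] [ExpChar R p]
  [AddCommGroup M] [Module R M] [AddCommGroup N] [Module R N]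

instance (M : Type*) [AddCommGroup M] : AddCommGroup (FrobPush p e M) :=
  inferInstanceAs (AddCommGroup M)

instance : Module R (FrobPush p e M) :=
  Module.compHom M (iterateFrobenius R p e)

/-- The identity map `M → F^e_* M`, `m ↦ F^e_* m`. -/
def of (M : Type*) [AddCommGroup M] : M ≃+ FrobPush p e M := AddEquiv.refl M

theorem smul_of (r : R) (m : M) : r • of p e M m = of p e M (r ^ p ^ e • m) := rfl

theorem smul_eq (r : R) (x : FrobPush p e M) :
    r • x = of p e M (r ^ p ^ e • (of p e M).symm x) := rfl

variable {p d} in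
/-- The functor `F^e_*` on `R`-linear maps. -/
def map (ρ : M →ₗ[R] N) : FrobPush p e M →ₗ[R] FrobPush p e N where
  toFun x := of p e N (ρ ((of p e M).symm x))
  map_add' x y := by simp
  map_smul' r x := by simp [smul_eq]

variable {p e d} in
/-- The composition `φ ∘ F^d_* ϑ : F^{d+e}_* M → F^d_* R → R` of `φ : F^d_* R → R`
and `ϑ : F^e_* M → R`, where `F^d_* F^e_* M` is identified with `F^{d+e}_* M`. -/
def comp (φ : FrobPush p d R →ₗ[R] R) (ϑ : FrobPush p e M →ₗ[R] R) :
    FrobPush p (d + e) M →ₗ[R] R where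
  toFun x := φ (of p d R (ϑ (of p e M ((of p (d + e) M).symm x))))
  map_add' x y := by simp
  map_smul' r x := by
    have h : of p e M (r ^ p ^ (d + e) • (of p (d + e) M).symm x)
        = r ^ p ^ d • of p e M ((of p (d + e) M).symm x) := by
      rw [smul_of, ← pow_mul, ← pow_add]
    rw [smul_eq, AddEquiv.symm_apply_apply, h, map_smul, smul_eq_mul, ← smul_eq_mul,
      ← smul_of, map_smul, RingHom.id_apply]

end FrobPush

/-- A Cartier subalgebra `C = ⨁ C_e` of the full Cartier algebra `⨁ Hom_R(F^e_* R, R)`: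
a graded subring, closed under the left `R`-action, with `C_0 = R = Hom_R(R, R)`. (Closure
under the right action `φ ↦ φ(F^e_* r · -)` is multiplication by elements of `C_0`.) -/
structure CartierSubalgebra (R : Type*) [CommRing R] (p : ℕ) [ExpChar R p] where
  /-- The homogeneous component `C_e`. -/
  deg : (e : ℕ) → Submodule R (FrobPush p e R →ₗ[R] R)
  deg_zero : deg 0 = ⊤
  comp_mem : ∀ {d e : ℕ} {φ : FrobPush p d R →ₗ[R] R} {ψ : FrobPush p e R →ₗ[R] R},
    φ ∈ deg d → ψ ∈ deg e → FrobPush.comp φ ψ ∈ deg (d + e)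

/-- A graded left `C`-submodule of `M^♭ = ⨁ Hom_R(F^e_* M, R)`. -/
structure FlatSubmodule {R : Type*} [CommRing R] {p : ℕ} [ExpChar R p]
    (C : CartierSubalgebra R p) (M : Type*) [AddCommGroup M] [Module R M] where
  /-- The homogeneous component of degree `e`. -/
  deg : (e : ℕ) → Submodule R (FrobPush p e M →ₗ[R] R)
  comp_mem : ∀ {d e : ℕ} {φ : FrobPush p d R →ₗ[R] R} {ϑ : FrobPush p e M →ₗ[R] R},
    φ ∈ C.deg d → ϑ ∈ deg e → FrobPush.comp φ ϑ ∈ deg (d + e)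

section SplittingNumbers

variable (R : Type*) [CommRing R] [IsLocalRing R] (p : ℕ)

/-- The maps `F^e_* M → R` with image in the maximal ideal, `Hom_R(F^e_* M, 𝔪)`. -/
def nonsplit [ExpChar R p] (e : ℕ) (M : Type*) [AddCommGroup M] [Module R M] :
    Submodule R (FrobPush p e M →ₗ[R] R) where
  carrier := {ϑ | ∀ x, ϑ x ∈ IsLocalRing.maximalIdeal R}
  add_mem' ha hb x := add_mem (ha x) (hb x)
  zero_mem' _ := zero_mem _
  smul_mem' r _ h x := Ideal.mul_mem_left _ r (h x)

variable [Fact p.Prime] [CharP R p]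

instance residueFieldCharP : CharP (IsLocalRing.ResidueField R) p :=
  (CharP.charP_iff_prime_eq_zero (Fact.out : p.Prime)).2 (by
    rw [← map_natCast (IsLocalRing.residue R), CharP.cast_eq_zero, map_zero])

/-- `δ = dim R + log_p [k^{1/p} : k]`, where `k` is the residue field of `R` and
`[k^{1/p} : k]` is the dimension of `F_* k` over `k`. -/
def deltaExp : ℝ :=
  (((ringKrullDim R).unbotD 0).toNat : ℝ) +
    Real.logb p (Module.finrank (IsLocalRing.ResidueField R)
      (FrobPush p 1 (IsLocalRing.ResidueField R)))

end SplittingNumbers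

namespace FlatSubmodule

variable {R : Type*} [CommRing R] [IsLocalRing R] {p : ℕ} [Fact p.Prime] [CharP R p]
  {C : CartierSubalgebra R p} {M : Type*} [AddCommGroup M] [Module R M]

/-- The splitting number `a_e`: the length of `𝓜_e / 𝓜_e^{ns}`, where
`𝓜_e^{ns} = 𝓜_e ∩ Hom_R(F^e_* M, 𝔪)`. -/
def splittingNumber (𝓜 : FlatSubmodule C M) (e : ℕ) : ℕ∞ :=
  Module.length R (𝓜.deg e ⧸ (nonsplit R p e M).submoduleOf (𝓜.deg e))

/-- `n = gcd {e | a_e ≠ 0}`; it is `0` if and only if `a_e = 0` for all `e > 0`. -/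
def period (𝓜 : FlatSubmodule C M) : ℕ :=
  Nat.setGcd {e | 𝓜.splittingNumber e ≠ 0}

/-- The sequence `a_{e n} / q^δ`, `q = p^{e n}`. -/
def splittingSeq (𝓜 : FlatSubmodule C M) (e : ℕ) : ℝ :=
  ((𝓜.splittingNumber (e * 𝓜.period)).toNat : ℝ) /
    ((p : ℝ) ^ (e * 𝓜.period)) ^ deltaExp R p

/-- The limit that defines the splitting ratio exists (there is no limit to take if there
are no splittings in positive degrees). -/
def SplittingRatioExists (𝓜 : FlatSubmodule C M) : Prop :=
  𝓜.period ≠ 0 → ∃ r : ℝ, Tendsto 𝓜.splittingSeq atTop (𝓝 r)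

open Classical in
/-- The splitting ratio `asr(𝓜) = lim_e a_{e n} / q^δ`, which is `0` by convention if
`a_e = 0` for all `e > 0`. -/
def splittingRatio (𝓜 : FlatSubmodule C M) : ℝ :=
  if 𝓜.period = 0 then 0 else limUnder atTop 𝓜.splittingSeq

end FlatSubmodule

namespace CartierSubalgebra

variable {R : Type*} [CommRing R] {p : ℕ}

/-- `C` as a graded left module over itself, inside `R^♭ = ⨁ Hom_R(F^e_* R, R)`. -/
def self [ExpChar R p] (C : CartierSubalgebra R p) : FlatSubmodule C R where
  deg := C.deg
  comp_mem := C.comp_mem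

/-- The `F`-signature `s(R, C)`. -/
def fSignature [IsLocalRing R] [Fact p.Prime] [CharP R p] (C : CartierSubalgebra R p) : ℝ :=
  C.self.splittingRatio

/-- The graded module `M^♮`: in degree `e`, the additive subgroup of `Hom_R(F^e_* M, R)`
generated by all `φ ∘ F^e_* ρ` with `φ ∈ C_e` and `ρ ∈ Hom_R(M, R)`. -/
def natural [ExpChar R p] (C : CartierSubalgebra R p) (M : Type*) [AddCommGroup M]
    [Module R M] : FlatSubmodule C M where
  deg e :=
    { AddSubgroup.closure {ϑ : FrobPush p e M →ₗ[R] R |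
        ∃ φ ∈ C.deg e, ∃ ρ : M →ₗ[R] R, ϑ = φ ∘ₗ FrobPush.map e ρ} with
      smul_mem' := by
        intro r ϑ hϑ
        refine AddSubgroup.closure_induction (p := fun ϑ _ => r • ϑ ∈ AddSubgroup.closure _)
          ?_ ?_ ?_ ?_ hϑ
        · rintro _ ⟨φ, hφ, ρ, rfl⟩
          exact AddSubgroup.subset_closure ⟨r • φ, (C.deg e).smul_mem r hφ, ρ, rfl⟩
        · rw [smul_zero]; exact zero_mem _
        · intro x y _ _ hx hy
          rw [smul_add]; exact add_mem hx hy
        · intro x _ hx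
          rw [smul_neg]; exact neg_mem hx }
  comp_mem := by
    intro d e φ ϑ hφ hϑ
    refine AddSubgroup.closure_induction
      (p := fun ϑ _ => FrobPush.comp φ ϑ ∈ AddSubgroup.closure _) ?_ ?_ ?_ ?_ hϑ
    · rintro _ ⟨ψ, hψ, ρ, rfl⟩
      exact AddSubgroup.subset_closure ⟨FrobPush.comp φ ψ, C.comp_mem hφ hψ, ρ, rfl⟩
    · have : FrobPush.comp φ (0 : FrobPush p e M →ₗ[R] R) = 0 := by
        ext x; simp [FrobPush.comp]
      rw [this]; exact zero_mem _
    · intro x y _ _ hx hy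
      have : FrobPush.comp φ (x + y) = FrobPush.comp φ x + FrobPush.comp φ y := by
        ext z; simp [FrobPush.comp]
      rw [this]; exact add_mem hx hy
    · intro x _ hx
      have : FrobPush.comp φ (-x) = -FrobPush.comp φ x := by
        ext z; simp [FrobPush.comp]
      rw [this]; exact neg_mem hx

end CartierSubalgebra

end

/-!
Let `S_e = {m | ϑ(F^e_* m) ∈ 𝔪 for all ϑ ∈ 𝓜_e}`. Evaluation induces a perfect pairing of
`𝓜_e / 𝓜_e^{ns}` with `F^e_* M / F^e_* S_e` into the residue field `k`, so that
`a_e(𝓜) = [k^{1/p} : k]^e * length (M / S_e)`, and `a_e(𝓜) / q^δ`, `q = p^e`, is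
`length (M / S_e) / q^(dim R)`. For `𝓜 = C` this `S_e` is the splitting ideal `I_e`, which contains
`𝔪^{[q]}`, and for `𝓜 = M^♮` it consists of the `m` with `ρ(m) ∈ I_e` for all `ρ ∈ Hom_R(M, R)`.

Since `R` is a domain, `M` agrees with a free module of its rank up to modules killed by some
`c ≠ 0`. Passing to `R / c` lowers the dimension, so such modules contribute only
`O(q^(dim R - 1))` to the lengths. Hence the density of `M^♮` in degree `e` is the rank of `M`
times that of `C`, up to `O(1 / q)`.

The density `u_e` of `C` is bounded. A nonzero `φ ∈ C_f` generates `Hom_R(F^f_* R, R)` up to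
torsion, and its multiples map `F^f_* I_{e+f}` into `I_e`; as `F^f_* R` has rank at least `p^(f δ)`,
this gives `u_e ≤ u_{e+f} + O(1 / q)` for every `f` in the semigroup of degrees in which `C` splits.
So `u` converges along the multiples of the gcd of that semigroup.
-/

noncomputable section

section Length

variable {R : Type*} [CommRing R] {A B : Type*} [AddCommGroup A] [AddCommGroup B]
  [Module R A] [Module R B]

theorem length_quotient_le_of_le {S T : Submodule R A} (h : S ≤ T) :
    Module.length R (A ⧸ T) ≤ Module.length R (A ⧸ S) :=
  Module.length_le_of_surjective (Submodule.factor h) (Submodule.factor_surjective h)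

theorem length_quotient_eq_length_comap_add (g : A →ₗ[R] B) (S : Submodule R B) :
    Module.length R (B ⧸ S) =
      Module.length R (A ⧸ S.comap g) + Module.length R (B ⧸ LinearMap.range g ⊔ S) := by
  refine Module.length_eq_add_of_exact ((S.comap g).mapQ S g le_rfl)
    (Submodule.factor le_sup_right) ?_ (Submodule.factor_surjective _) ?_
  · rw [← LinearMap.ker_eq_bot]
    refine Submodule.ker_liftQ_eq_bot _ _ _ ?_
    rw [LinearMap.ker_comp, Submodule.ker_mkQ]
  · rw [LinearMap.exact_iff, Submodule.mapQ, Submodule.range_liftQ, LinearMap.range_comp]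
    refine Submodule.comap_injective_of_surjective S.mkQ_surjective ?_
    rw [Submodule.comap_map_mkQ, ← LinearMap.ker_comp]
    change LinearMap.ker (Submodule.mkQ (LinearMap.range g ⊔ S)) = _
    rw [Submodule.ker_mkQ, sup_comm]

theorem comap_mkQ_smul_top (N : Submodule R A) (I : Ideal R) :
    (I • ⊤ : Submodule R (A ⧸ N)).comap N.mkQ = N ⊔ I • ⊤ := by
  rw [← N.range_mkQ, ← Submodule.map_top, ← Submodule.map_smul'', Submodule.comap_map_mkQ]

theorem length_pi_quotient (ι : Type*) [Fintype ι] (S : Submodule R A) :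
    Module.length R ((ι → A) ⧸ Submodule.pi Set.univ fun _ : ι => S) =
      Fintype.card ι * Module.length R (A ⧸ S) := by
  classical
  rw [(Submodule.quotientPi fun _ : ι => S).length_eq]
  simp only [Module.length_pi, ENat.card_eq_coe_fintype_card]

theorem pi_le_comap_smul_top {ι : Type*} [Finite ι] (g : (ι → R) →ₗ[R] A) (I : Ideal R) :
    Submodule.pi Set.univ (fun _ : ι => I) ≤ (I • ⊤ : Submodule R A).comap g := by
  classical
  have := Fintype.ofFinite ι
  intro v hv
  rw [Submodule.mem_comap, pi_eq_sum_univ v, map_sum]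
  refine Submodule.sum_mem _ fun i _ => ?_
  rw [map_smul]
  exact Submodule.smul_mem_smul (hv i trivial) trivial

variable (R A) in
theorem exists_length_quotient_smul_top_le [Module.Finite R A] :
    ∃ r : ℕ, ∀ I : Ideal R,
      Module.length R (A ⧸ I • (⊤ : Submodule R A)) ≤ r * Module.length R (R ⧸ I) := by
  obtain ⟨r, f, hf⟩ := Module.Finite.exists_fin' R A
  refine ⟨r, fun I => ?_⟩
  have hle := pi_le_comap_smul_top f I
  have hsurj : Function.Surjective (Submodule.mapQ _ _ f hle) :=
    .of_comp (g := Submodule.mkQ _) ((Submodule.mkQ_surjective _).comp hf)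
  simpa only [length_pi_quotient, Fintype.card_fin] using Module.length_le_of_surjective _ hsurj

theorem length_quotient_sup_span_pow_le (I : Ideal R) (x : R) (q : ℕ) :
    Module.length R (R ⧸ I ⊔ Ideal.span {x ^ q}) ≤
      q * Module.length R (R ⧸ I ⊔ Ideal.span {x}) := by
  induction q with
  | zero =>
    rw [Nat.cast_zero, zero_mul, nonpos_iff_eq_zero, Module.length_eq_zero_iff]
    simp only [pow_zero, Ideal.span_singleton_one, le_top, sup_of_le_right]
    infer_instance
  | succ q ih =>
    have hcomap : I ⊔ Ideal.span {x} ≤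
        Submodule.comap (LinearMap.mulLeft R (x ^ q)) (I ⊔ Ideal.span {x ^ (q + 1)}) := by
      refine sup_le (fun y hy => Ideal.mul_mem_left _ _ (Ideal.mem_sup_left hy)) ?_
      rw [Ideal.span_singleton_le_iff_mem, Submodule.mem_comap, LinearMap.mulLeft_apply,
        ← pow_succ]
      exact Ideal.mem_sup_right (Ideal.mem_span_singleton_self _)
    have hrange : I ⊔ Ideal.span {x ^ q} ≤
        LinearMap.range (LinearMap.mulLeft R (x ^ q)) ⊔ (I ⊔ Ideal.span {x ^ (q + 1)}) := by
      refine sup_le (le_sup_left.trans le_sup_right) (le_sup_of_le_left ?_)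
      rw [Ideal.span_singleton_le_iff_mem]
      exact ⟨1, mul_one _⟩
    calc Module.length R (R ⧸ I ⊔ Ideal.span {x ^ (q + 1)})
        = _ := length_quotient_eq_length_comap_add (LinearMap.mulLeft R (x ^ q)) _
      _ ≤ Module.length R (R ⧸ I ⊔ Ideal.span {x}) +
          Module.length R (R ⧸ I ⊔ Ideal.span {x ^ q}) :=
        add_le_add (length_quotient_le_of_le hcomap) (length_quotient_le_of_le hrange)
      _ ≤ Module.length R (R ⧸ I ⊔ Ideal.span {x}) +
          q * Module.length R (R ⧸ I ⊔ Ideal.span {x}) := by gcongr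
      _ = (q + 1 : ℕ) * Module.length R (R ⧸ I ⊔ Ideal.span {x}) := by push_cast; ring

theorem length_quotient_sup_span_image_pow_le (s : Finset R) (q : ℕ) (I : Ideal R) :
    Module.length R (R ⧸ I ⊔ Ideal.span ((· ^ q) '' (s : Set R))) ≤
      (q : ℕ∞) ^ s.card * Module.length R (R ⧸ I ⊔ Ideal.span (s : Set R)) := by
  classical
  induction s using Finset.induction_on generalizing I with
  | empty => rw [Finset.coe_empty, Set.image_empty, Finset.card_empty, pow_zero, one_mul]
  | insert x s hx ih =>
    rw [Finset.coe_insert, Set.image_insert_eq, Ideal.span_insert, Ideal.span_insert,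
      ← sup_assoc, Finset.card_insert_of_notMem hx, pow_succ, mul_assoc]
    refine (ih _).trans ?_
    gcongr
    rw [sup_right_comm, ← sup_assoc, sup_right_comm _ (Ideal.span {x})]
    exact length_quotient_sup_span_pow_le _ _ _

end Length

section Pairing

variable {R : Type*} [CommRing R] {K : Type*} [AddCommGroup K] [Module R K] [IsSimpleModule R K]

theorem length_hom_le_one (Y : Type*) [AddCommGroup Y] [Module R Y] [IsSimpleModule R Y] :
    Module.length R (Y →ₗ[R] K) ≤ 1 := by
  have := IsSimpleModule.nontrivial R Y
  obtain ⟨y, hy⟩ := exists_ne (0 : Y)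
  rw [← Module.length_eq_one R K]
  refine Module.length_le_of_injective (LinearMap.applyₗ y) fun f g hfg => ?_
  refine LinearMap.ext_on_range (v := fun _ : Unit => y) ?_ fun _ => hfg
  rw [Set.range_const, IsSimpleModule.span_singleton_eq_top R hy]

variable (K) in
theorem length_hom_le_length (Y : Type*) [AddCommGroup Y] [Module R Y] :
    Module.length R (Y →ₗ[R] K) ≤ Module.length R Y := by
  by_cases hY : Module.length R Y = ⊤
  · exact hY ▸ le_top
  rw [← ne_eq, Module.length_ne_top_iff] at hY
  induction hY with
  | of_subsingleton => rw [Module.length_eq_zero]; exact zero_le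
  | @of_simple_quotient Y _ _ N _ _ ih =>
    let res : (Y →ₗ[R] K) →ₗ[R] (N →ₗ[R] K) := LinearMap.lcomp R K N.subtype
    have hker : Module.length R (LinearMap.ker res) ≤ Module.length R ((Y ⧸ N) →ₗ[R] K) := by
      let lift : LinearMap.ker res →ₗ[R] ((Y ⧸ N) →ₗ[R] K) :=
        { toFun f := N.liftQ f.1 fun y hy => LinearMap.congr_fun f.2 ⟨y, hy⟩
          map_add' f g := by ext; rfl
          map_smul' r f := by ext; rfl }
      refine Module.length_le_of_injective lift fun f g hfg => ?_
      ext y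
      exact LinearMap.congr_fun hfg (N.mkQ y)
    calc Module.length R (Y →ₗ[R] K)
        = Module.length R (LinearMap.ker res) + Module.length R (LinearMap.range res) :=
          Module.length_eq_add_of_exact _ res.rangeRestrict (Submodule.subtype_injective _)
            res.surjective_rangeRestrict
            (LinearMap.exact_iff.2 (by rw [LinearMap.ker_rangeRestrict, Submodule.range_subtype]))
      _ ≤ 1 + Module.length R N :=
        add_le_add (hker.trans (length_hom_le_one _))
          ((Module.length_le_of_injective _ (Submodule.subtype_injective _)).trans ih)
      _ = Module.length R Y := by
        rw [Module.length_eq_add_of_exact N.subtype N.mkQ N.subtype_injective N.mkQ_surjective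
          (LinearMap.exact_subtype_mkQ N), Module.length_eq_one R (Y ⧸ N), add_comm]

variable {W X : Type*} [AddCommGroup W] [AddCommGroup X] [Module R W] [Module R X]

theorem length_quotient_ker_le (B : W →ₗ[R] X →ₗ[R] K) :
    Module.length R (W ⧸ LinearMap.ker B) ≤ Module.length R (X ⧸ LinearMap.ker B.flip) := by
  let descent : W →ₗ[R] (X ⧸ LinearMap.ker B.flip) →ₗ[R] K :=
    ((LinearMap.ker B.flip).liftQ B.flip le_rfl).flip
  have hker : LinearMap.ker B = LinearMap.ker descent := by
    ext w
    simp only [LinearMap.mem_ker, LinearMap.ext_iff, (Submodule.mkQ_surjective _).forall]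
    rfl
  have hinj := LinearMap.ker_eq_bot.1
    (Submodule.ker_liftQ_eq_bot (LinearMap.ker B) descent hker.le hker.ge)
  exact (Module.length_le_of_injective _ hinj).trans (length_hom_le_length K _)

theorem length_quotient_ker_eq (B : W →ₗ[R] X →ₗ[R] K) :
    Module.length R (W ⧸ LinearMap.ker B) = Module.length R (X ⧸ LinearMap.ker B.flip) :=
  (length_quotient_ker_le B).antisymm (length_quotient_ker_le B.flip)

variable [IsLocalRing R]

/-- The vectors that every functional in `W` maps into the maximal ideal. -/
def maximalOrthogonal (W : Submodule R (X →ₗ[R] R)) : Submodule R X :=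
  ⨅ w ∈ W, Submodule.comap w (IsLocalRing.maximalIdeal R)

theorem mem_maximalOrthogonal {W : Submodule R (X →ₗ[R] R)} {x : X} :
    x ∈ maximalOrthogonal W ↔ ∀ w ∈ W, w x ∈ IsLocalRing.maximalIdeal R := by
  simp only [maximalOrthogonal, Submodule.mem_iInf, Submodule.mem_comap]

instance isSimpleModule_residueField : IsSimpleModule R (IsLocalRing.ResidueField R) :=
  isSimpleModule_iff_isCoatom.2 (Ideal.isMaximal_def.1 inferInstance)

theorem length_quotient_submoduleOf_eq_length_quotient_maximalOrthogonal
    (W ns : Submodule R (X →ₗ[R] R))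
    (hns : ∀ w, w ∈ ns ↔ ∀ x, w x ∈ IsLocalRing.maximalIdeal R) :
    Module.length R (W ⧸ ns.submoduleOf W) = Module.length R (X ⧸ maximalOrthogonal W) := by
  let B : W →ₗ[R] X →ₗ[R] IsLocalRing.ResidueField R :=
    (LinearMap.llcomp R X R _ (Algebra.linearMap R _)) ∘ₗ W.subtype
  have hB (w : W) (x : X) : B w x = 0 ↔ w.1 x ∈ IsLocalRing.maximalIdeal R :=
    IsLocalRing.residue_eq_zero_iff _
  have hleft : LinearMap.ker B = ns.submoduleOf W := by
    ext w
    rw [LinearMap.mem_ker, LinearMap.ext_iff]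
    exact (forall_congr' (hB w)).trans (hns w.1).symm
  have hright : LinearMap.ker B.flip = maximalOrthogonal W := by
    ext x
    rw [LinearMap.mem_ker, LinearMap.ext_iff, mem_maximalOrthogonal]
    exact (forall_congr' fun w => hB w x).trans Subtype.forall
  rw [← hleft, ← hright, length_quotient_ker_eq]

end Pairing

section Growth

variable {R : Type*} [CommRing R] [IsNoetherianRing R]

theorem exists_mem_pow_smul_top_of_smul_mem {M : Type*} [AddCommGroup M] [Module R M]
    [Module.Finite R M] (I : Ideal R) {x : R} (hx : IsSMulRegular M x) :
    ∃ c : ℕ, ∀ (n : ℕ) (m : M), x • m ∈ (I ^ (n + c) • ⊤ : Submodule R M) →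
      m ∈ (I ^ n • ⊤ : Submodule R M) := by
  let mulx : M →ₗ[R] M := LinearMap.lsmul R M x
  obtain ⟨c, hc⟩ := I.exists_pow_inf_eq_pow_smul (LinearMap.range mulx)
  refine ⟨c, fun n m hm => ?_⟩
  have hartinRees : mulx m ∈ I ^ n • (I ^ c • ⊤ ⊓ LinearMap.range mulx) := by
    rw [← Nat.add_sub_cancel n c, ← hc (n + c) (Nat.le_add_left _ _)]
    exact ⟨hm, m, rfl⟩
  have hmem : mulx m ∈ (I ^ n • ⊤ : Submodule R M).map mulx := by
    rw [Submodule.map_smul'', Submodule.map_top]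
    exact Submodule.smul_mono le_rfl inf_le_right hartinRees
  obtain ⟨m', hm', hmm'⟩ := hmem
  exact hx hmm' ▸ hm'

-- Multiply by some `x ∈ Q \ P`, which is regular on `R / P`, and apply Artin-Rees.
theorem exists_length_quotient_sup_pow_add_le (I : Ideal R) {P Q : Ideal R} [P.IsPrime]
    (hPQ : P < Q) :
    ∃ c : ℕ, ∀ n, Module.length R (R ⧸ P ⊔ I ^ n) + Module.length R (R ⧸ Q ⊔ I ^ (n + c)) ≤
      Module.length R (R ⧸ P ⊔ I ^ (n + c)) := by
  obtain ⟨hle, x, hxQ, hxP⟩ := SetLike.lt_iff_le_and_exists.1 hPQ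
  have hx : IsSMulRegular (R ⧸ P) x :=
    (isSMulRegular_quotient_iff_mem_of_smul_mem P x).2 fun y hy =>
      (Ideal.IsPrime.mem_or_mem ‹_› hy).resolve_left hxP
  have mem_sup_iff (n : ℕ) (y : R) :
      P.mkQ y ∈ (I ^ n • ⊤ : Submodule R (R ⧸ P)) ↔ y ∈ P ⊔ I ^ n := by
    rw [← Submodule.mem_comap, comap_mkQ_smul_top, smul_eq_mul, Ideal.mul_top]
  obtain ⟨c, hc⟩ := exists_mem_pow_smul_top_of_smul_mem I hx
  refine ⟨c, fun n => ?_⟩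
  rw [length_quotient_eq_length_comap_add (LinearMap.mulLeft R x) (P ⊔ I ^ (n + c))]
  refine add_le_add (length_quotient_le_of_le fun y hy => ?_) (length_quotient_le_of_le ?_)
  · exact (mem_sup_iff n y).1 (hc n _ ((mem_sup_iff (n + c) (x * y)).2 hy))
  · refine sup_le ?_ (sup_le_sup_right hle _)
    rintro _ ⟨y, rfl⟩
    exact Ideal.mem_sup_left (Ideal.mul_mem_right y _ hxQ)

theorem exists_pow_length_le_length_quotient_sup_pow (I : Ideal R)
    (s : LTSeries (PrimeSpectrum R)) (hs : s.last.asIdeal ⊔ I ≠ ⊤) :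
    ∃ b : ℕ, ∀ n : ℕ, 1 ≤ n → (n : ℕ∞) ^ s.length ≤
      Module.length R (R ⧸ s.head.asIdeal ⊔ I ^ (b * n)) := by
  induction s using RelSeries.inductionOn with
  | singleton P =>
    refine ⟨1, fun n hn => ?_⟩
    rw [RelSeries.singleton_length, pow_zero, Order.one_le_iff_pos, Module.length_pos_iff,
      Submodule.Quotient.nontrivial_iff]
    exact ne_top_of_le_ne_top hs (sup_le_sup_left (Ideal.pow_le_self (by omega)) _)
  | cons s P hP ih =>
    obtain ⟨b, hb⟩ := ih (by rwa [RelSeries.last_cons] at hs)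
    obtain ⟨c, hc⟩ :=
      exists_length_quotient_sup_pow_add_le I (P := P.asIdeal) (Q := s.head.asIdeal) hP
    refine ⟨b + c, fun n hn => ?_⟩
    have growth (j : ℕ) : j * (n : ℕ∞) ^ s.length ≤
        Module.length R (R ⧸ P.asIdeal ⊔ I ^ (b * n + j * c)) := by
      induction j with
      | zero => simp only [Nat.cast_zero, zero_mul, zero_le]
      | succ j ihj =>
        calc ((j + 1 : ℕ) : ℕ∞) * (n : ℕ∞) ^ s.length
            = j * (n : ℕ∞) ^ s.length + (n : ℕ∞) ^ s.length := by push_cast; ring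
          _ ≤ Module.length R (R ⧸ P.asIdeal ⊔ I ^ (b * n + j * c)) +
              Module.length R (R ⧸ s.head.asIdeal ⊔ I ^ (b * n + j * c + c)) :=
            add_le_add ihj ((hb n hn).trans (length_quotient_le_of_le
              (sup_le_sup_left (Ideal.pow_le_pow_right (by omega)) _)))
          _ ≤ Module.length R (R ⧸ P.asIdeal ⊔ I ^ (b * n + j * c + c)) := hc _
          _ = _ := by rw [add_assoc (b * n), add_one_mul]
    rw [RelSeries.head_cons, RelSeries.cons_length, pow_succ', add_mul, mul_comm c n]
    exact growth n

end Growth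

section Parameters

/-- The Krull dimension of a noetherian local ring as a natural number, encoded as in
`deltaExp`. -/
abbrev localDim (R : Type*) [CommRing R] : ℕ := ((ringKrullDim R).unbotD 0).toNat

variable (R : Type*) [CommRing R] [IsNoetherianRing R] [IsLocalRing R]

open IsLocalRing

theorem coe_localDim : (localDim R : WithBot ℕ∞) = ringKrullDim R := by
  have hheight := Ideal.height_ne_top (maximalIdeal.isMaximal R).ne_top
  rw [localDim, ← maximalIdeal_height_eq_ringKrullDim, WithBot.unbotD_coe]
  conv_rhs => rw [← ENat.natCast_toNat hheight]
  rfl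

theorem exists_localDim_pow_le_length_quotient_pow : ∃ b : ℕ, ∀ n : ℕ, 1 ≤ n →
    (n : ℕ∞) ^ localDim R ≤ Module.length R (R ⧸ maximalIdeal R ^ (b * n)) := by
  obtain ⟨s, hs⟩ := Order.le_krullDim_iff.1 (coe_localDim R).le
  obtain ⟨b, hb⟩ := exists_pow_length_le_length_quotient_sup_pow (maximalIdeal R) s
    (ne_top_of_le_ne_top (maximalIdeal.isMaximal R).ne_top
      (sup_le (le_maximalIdeal s.last.2.ne_top) le_rfl))
  exact ⟨b, fun n hn => hs ▸ (hb n hn).trans (length_quotient_le_of_le le_sup_right)⟩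

variable {R}

theorem length_quotient_ne_top_of_mem_minimalPrimes {I : Ideal R}
    (hI : maximalIdeal R ∈ I.minimalPrimes) : Module.length R (R ⧸ I) ≠ ⊤ := by
  have := quotient_artinian_of_mem_minimalPrimes_of_isLocalRing I hI
  rw [Module.length_eq_of_surjective (R := R ⧸ I) Ideal.Quotient.mk_surjective]
  exact Module.length_ne_top

theorem exists_parameters_of_surjective {S : Type*} [CommRing S] [IsNoetherianRing S]
    [IsLocalRing S] {f : R →+* S} (hf : Function.Surjective f) :
    ∃ s : Finset R, s.card ≤ localDim S ∧ (s : Set R) ⊆ maximalIdeal R ∧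
      Module.length R (R ⧸ RingHom.ker f ⊔ Ideal.span (s : Set R)) ≠ ⊤ := by
  classical
  obtain ⟨t, ht, hcard⟩ := Ideal.exists_finset_card_eq_height_of_isNoetherianRing (maximalIdeal S)
  let s : Finset R := t.image (Function.surjInv hf)
  have himage : f '' (s : Set R) = t := by
    rw [Finset.coe_image, ← Set.image_comp, Function.comp_surjInv, Set.image_id]
  have hcomap : (Ideal.span (t : Set S)).comap f = RingHom.ker f ⊔ Ideal.span (s : Set R) := by
    rw [← himage, ← Ideal.map_span, Ideal.comap_map_of_surjective f hf,
      ← RingHom.ker_eq_comap_bot, sup_comm]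
  have hmin : maximalIdeal R ∈ (RingHom.ker f ⊔ Ideal.span (s : Set R)).minimalPrimes := by
    rw [← hcomap, Ideal.comap_minimalPrimes_eq_of_surjective hf]
    exact ⟨_, ht, eq_maximalIdeal (Ideal.comap_isMaximal_of_surjective f hf)⟩
  have ht_card : t.card = localDim S := by
    rw [← Nat.cast_inj (R := WithBot ℕ∞), coe_localDim, ← maximalIdeal_height_eq_ringKrullDim,
      ← hcard]
    rfl
  exact ⟨s, Finset.card_image_le.trans ht_card.le, Ideal.span_le.1 (le_sup_right.trans hmin.1.2),
    length_quotient_ne_top_of_mem_minimalPrimes hmin⟩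

end Parameters

section Frame

variable {R : Type*} [CommRing R]

theorem length_quotient_le_add_of_smul_mem_range {A B : Type*} [AddCommGroup A] [AddCommGroup B]
    [Module R A] [Module R B] (g : A →ₗ[R] B) {c : R} (hc : ∀ b, c • b ∈ LinearMap.range g)
    {I : Ideal R} {S : Submodule R A} {T : Submodule R B} (hST : S ≤ T.comap g)
    (hIT : I • ⊤ ≤ T) :
    Module.length R (B ⧸ T) ≤
      Module.length R (A ⧸ S) +
        Module.length R (B ⧸ (Ideal.span {c} ⊔ I) • (⊤ : Submodule R B)) := by
  have hcokernel : (Ideal.span {c} ⊔ I) • (⊤ : Submodule R B) ≤ LinearMap.range g ⊔ T := by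
    rw [Submodule.sup_smul, Submodule.ideal_span_singleton_smul]
    refine sup_le_sup ?_ hIT
    rintro _ ⟨b, _, rfl⟩
    exact hc b
  rw [length_quotient_eq_length_comap_add g T]
  exact add_le_add (length_quotient_le_of_le hST) (length_quotient_le_of_le hcokernel)

theorem exists_card_mul_length_quotient_le {ι M : Type*} [Fintype ι] [AddCommGroup M] [Module R M]
    (h : M →ₗ[R] (ι → R)) {c : R} (hc : ∀ v, c • v ∈ LinearMap.range h) :
    ∃ r : ℕ, ∀ (I : Ideal R) (S : Submodule R M), (∀ x ∈ S, ∀ i, h x i ∈ I) →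
      Fintype.card ι * Module.length R (R ⧸ I) ≤
        Module.length R (M ⧸ S) + r * Module.length R (R ⧸ Ideal.span {c} ⊔ I) := by
  obtain ⟨r, hr⟩ := exists_length_quotient_smul_top_le R (ι → R)
  refine ⟨r, fun I S hS => ?_⟩
  rw [← length_pi_quotient]
  refine (length_quotient_le_add_of_smul_mem_range h hc (I := I)
    (T := Submodule.pi Set.univ fun _ => I) (fun x hx i _ => hS x hx i)
    ?_).trans (add_le_add le_rfl (hr _))
  rw [Submodule.smul_le]
  exact fun a ha v _ i _ => Ideal.mul_mem_right _ _ ha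

variable [IsDomain R]

theorem exists_ne_zero_smul_mem_range {M N : Type*} [AddCommGroup M] [Module R M]
    [AddCommGroup N] [Module R N] [Module.Finite R N] {g : M →ₗ[R] N}
    (hg : Function.Injective g) (hrank : Module.finrank R N ≤ Module.finrank R M) :
    ∃ c : R, c ≠ 0 ∧ ∀ n, c • n ∈ LinearMap.range g := by
  have hcokernel : Module.finrank R (N ⧸ LinearMap.range g) = 0 := by
    have hrange := LinearMap.finrank_range_of_inj hg
    have hadd := Submodule.finrank_quotient_add_finrank (LinearMap.range g)
    omega
  obtain ⟨c, hc, hc0⟩ := Submodule.annihilator_top_inter_nonZeroDivisors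
    (Module.finrank_eq_zero_iff_isTorsion.1 hcokernel)
  refine ⟨c, nonZeroDivisors.ne_zero hc0, fun n => ?_⟩
  rw [← Submodule.Quotient.mk_eq_zero, Submodule.Quotient.mk_smul]
  exact Submodule.mem_annihilator.1 hc _ trivial

variable (R) (M : Type*) [AddCommGroup M] [Module R M] [Module.Finite R M]

theorem exists_quasiInverse :
    ∃ c : R, c ≠ 0 ∧ ∃ (g : (Fin (Module.finrank R M) → R) →ₗ[R] M)
      (h : M →ₗ[R] (Fin (Module.finrank R M) → R)),
      (∀ m, g (h m) = c • m) ∧ ∀ v, h (g v) = c • v := by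
  obtain ⟨x, hx⟩ := exists_linearIndependent_of_le_finrank (R := R) (M := M) le_rfl
  let g := Fintype.linearCombination R x
  have hg : Function.Injective g := linearIndependent_iff_injective_fintypeLinearCombination.1 hx
  obtain ⟨c, hc, hrange⟩ := exists_ne_zero_smul_mem_range hg (Module.finrank_fin_fun R).ge
  let e := LinearEquiv.ofInjective g hg
  let h : M →ₗ[R] (Fin (Module.finrank R M) → R) :=
    e.symm.toLinearMap ∘ₗ (LinearMap.lsmul R M c).codRestrict (LinearMap.range g) hrange
  have hgh (m : M) : g (h m) = c • m := congrArg Subtype.val (e.apply_symm_apply ⟨c • m, hrange m⟩)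
  exact ⟨c, hc, g, h, hgh, fun v => hg (by rw [hgh, map_smul])⟩

theorem exists_length_quotient_le_finrank_mul :
    ∃ (c : R) (r : ℕ), c ≠ 0 ∧ ∀ (I : Ideal R) (S : Submodule R M), I • ⊤ ≤ S →
      Module.length R (M ⧸ S) ≤
        Module.finrank R M * Module.length R (R ⧸ I) +
          r * Module.length R (R ⧸ Ideal.span {c} ⊔ I) := by
  obtain ⟨c, hc, g, h, hgh, -⟩ := exists_quasiInverse R M
  obtain ⟨r, hr⟩ := exists_length_quotient_smul_top_le R M
  refine ⟨c, r, hc, fun I S hIS => ?_⟩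
  have hpi := (pi_le_comap_smul_top g I).trans (Submodule.comap_mono hIS)
  have hle := length_quotient_le_add_of_smul_mem_range g (fun m => ⟨h m, hgh m⟩) hpi hIS
  rw [length_pi_quotient, Fintype.card_fin] at hle
  exact hle.trans (add_le_add le_rfl (hr _))

end Frame

theorem finite_compHom {A B : Type*} [CommRing A] [CommRing B] {f : A →+* B} (hf : f.Finite)
    (M : Type*) [AddCommGroup M] [Module B M] [Module.Finite B M] :
    let := Module.compHom M f
    Module.Finite A M := by
  let := f.toAlgebra
  let := Module.compHom M f
  have : IsScalarTower A B M := ⟨fun a b m => mul_smul (f a) b m⟩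
  have : Module.Finite A B := hf
  exact Module.Finite.trans B M

theorem finite_iterateFrobenius {R : Type*} [CommRing R] {p : ℕ} [ExpChar R p]
    (hF : (frobenius R p).Finite) (e : ℕ) : (iterateFrobenius R p e).Finite := by
  rw [iterateFrobenius_eq_pow]
  induction e with
  | zero => exact RingHom.Finite.id R
  | succ e ih => exact ih.comp hF

namespace FrobPush

section

variable {p : ℕ} (e d : ℕ) {R M N : Type*} [CommRing R] [ExpChar R p]
  [AddCommGroup M] [Module R M] [AddCommGroup N] [Module R N]

instance [Nontrivial M] : Nontrivial (FrobPush p e M) := inferInstanceAs (Nontrivial M)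

instance [Subsingleton M] : Subsingleton (FrobPush p e M) := inferInstanceAs (Subsingleton M)

theorem finite (hF : (frobenius R p).Finite) [Module.Finite R M] :
    Module.Finite R (FrobPush p e M) :=
  finite_compHom (finite_iterateFrobenius hF e) M

theorem map_surjective {f : M →ₗ[R] N} (hf : Function.Surjective f) :
    Function.Surjective (map (p := p) e f) := hf

/-- The submodule `F^e_* S` of `F^e_* M`, as the kernel of `F^e_* M → F^e_* (M / S)`. -/
def submodule (S : Submodule R M) : Submodule R (FrobPush p e M) :=
  LinearMap.ker (map e S.mkQ)

theorem mem_submodule {S : Submodule R M} {m : M} : of p e M m ∈ submodule e S ↔ m ∈ S :=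
  Submodule.Quotient.mk_eq_zero S

/-- The isomorphism `F^e_* M / F^e_* S ≃ F^e_* (M / S)`. -/
def quotientEquiv (S : Submodule R M) :
    (FrobPush p e M ⧸ submodule (p := p) e S) ≃ₗ[R] FrobPush p e (M ⧸ S) :=
  (map e S.mkQ).quotKerEquivOfSurjective (map_surjective e S.mkQ_surjective)

/-- The isomorphism `F^0_* M ≃ M`. -/
def zeroEquiv : FrobPush p 0 M ≃ₗ[R] M where
  __ := (of p 0 M).symm
  map_smul' r x := by
    change (of p 0 M).symm (r • x) = r • (of p 0 M).symm x
    rw [smul_eq, AddEquiv.symm_apply_apply, pow_zero, pow_one]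

/-- The isomorphism `F^d_* F^e_* M ≃ F^{d+e}_* M`. -/
def addEquiv : FrobPush p d (FrobPush p e M) ≃ₗ[R] FrobPush p (d + e) M where
  toFun x := of p (d + e) M ((of p e M).symm ((of p d _).symm x))
  invFun x := of p d _ (of p e M ((of p (d + e) M).symm x))
  left_inv _ := rfl
  right_inv _ := rfl
  map_add' _ _ := rfl
  map_smul' r x := by
    simp only [smul_eq, AddEquiv.symm_apply_apply, RingHom.id_apply]
    rw [← pow_mul, ← pow_add]

/-- The functor `F^e_*` on isomorphisms. -/
def congr (f : M ≃ₗ[R] N) : FrobPush p e M ≃ₗ[R] FrobPush p e N :=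
  LinearEquiv.ofBijective (map e f.toLinearMap) f.bijective

variable (M) in
theorem length_le_length : Module.length R M ≤ Module.length R (FrobPush p e M) := by
  rw [← WithBot.coe_le_coe, Module.coe_length, Module.coe_length]
  refine Order.krullDim_le_of_strictMono (submodule e) (strictMono_of_le_iff_le fun S T => ?_)
  exact ⟨fun h x hx => (mem_submodule e).2 (h ((mem_submodule e).1 hx)),
    fun h x hx => (mem_submodule e).1 (h ((mem_submodule e).2 hx))⟩

end

section

variable {R : Type*} [CommRing R] [IsLocalRing R] {p : ℕ} [Fact p.Prime] [CharP R p]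

open IsLocalRing

variable (R p) in
/-- The degree `[k^{1/p} : k]` of the residue field `k`, encoded as in `deltaExp`. -/
def residueDegree : ℕ :=
  Module.finrank (ResidueField R) (FrobPush p 1 (ResidueField R))

variable (hF : (frobenius R p).Finite)
include hF

theorem length_one_residueField :
    Module.length R (FrobPush p 1 (ResidueField R)) = residueDegree R p := by
  have : IsScalarTower R (ResidueField R) (FrobPush p 1 (ResidueField R)) := by
    refine .of_algebraMap_smul fun r x => ?_
    rw [smul_eq, smul_eq, ← map_pow, algebraMap_smul]
  have := finite 1 (M := ResidueField R) hF
  have := Module.Finite.of_restrictScalars_finite R (ResidueField R)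
    (FrobPush p 1 (ResidueField R))
  rw [Module.length_eq_of_surjective (R := ResidueField R) residue_surjective,
    Module.length_eq_finrank, residueDegree]

theorem residueDegree_pos : 0 < residueDegree R p := by
  rw [← Nat.cast_pos (α := ℕ∞), ← length_one_residueField hF]
  exact Module.length_pos

theorem length_one {N : Type*} [AddCommGroup N] [Module R N] (hN : IsFiniteLength R N) :
    Module.length R (FrobPush p 1 N) = residueDegree R p * Module.length R N := by
  induction hN with
  | of_subsingleton => rw [Module.length_eq_zero, Module.length_eq_zero, mul_zero]
  | @of_simple_quotient M _ _ N hsimple _ ih =>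
    have hquot : Module.length R (FrobPush p 1 (M ⧸ N)) = residueDegree R p := by
      obtain ⟨I, hI, ⟨e⟩⟩ := isSimpleModule_iff_quot_maximal.1 hsimple
      obtain rfl := eq_maximalIdeal hI
      rw [← length_one_residueField hF]
      exact (congr 1 e).length_eq
    rw [Module.length_eq_add_of_exact N.subtype N.mkQ N.subtype_injective N.mkQ_surjective
      (LinearMap.exact_subtype_mkQ N),
      Module.length_eq_add_of_exact (map (p := p) 1 N.subtype) (map (p := p) 1 N.mkQ)
      N.subtype_injective N.mkQ_surjective (LinearMap.exact_subtype_mkQ N), ih, hquot, mul_add,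
      Module.length_eq_one R (M ⧸ N), mul_one]

theorem length_eq (e : ℕ) (N : Type*) [AddCommGroup N] [Module R N] :
    Module.length R (FrobPush p e N) = (residueDegree R p : ℕ∞) ^ e * Module.length R N := by
  by_cases hN : Module.length R N = ⊤
  · rw [hN, ENat.mul_top, ← top_le_iff, ← hN]
    · exact length_le_length e N
    · exact pow_ne_zero e (Nat.cast_ne_zero.2 (residueDegree_pos hF).ne')
  induction e generalizing N with
  | zero => rw [pow_zero, one_mul, zeroEquiv.length_eq]
  | succ e ih =>
    have hone := length_one hF (Module.length_ne_top_iff.1 hN)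
    have hfin : Module.length R (FrobPush p 1 N) ≠ ⊤ := by
      rw [hone]
      exact WithTop.mul_ne_top (ENat.natCast_ne_top _) hN
    rw [← (addEquiv 1 e).length_eq, ih _ hfin, hone, pow_succ, mul_assoc]

theorem length_quotient_submodule (e : ℕ) {M : Type*} [AddCommGroup M] [Module R M]
    (S : Submodule R M) :
    Module.length R (FrobPush p e M ⧸ submodule (p := p) e S) =
      (residueDegree R p : ℕ∞) ^ e * Module.length R (M ⧸ S) := by
  rw [(quotientEquiv e S).length_eq, length_eq hF]

end

section

variable {R : Type*} [CommRing R] [IsDomain R] {p : ℕ} [ExpChar R p]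

theorem eq_zero_of_forall_mul {f : ℕ} {φ : FrobPush p f R →ₗ[R] R} {z : R} (hz : z ≠ 0)
    (h : ∀ y, φ (of p f R (y * z)) = 0) : φ = 0 := by
  ext x
  obtain ⟨t, rfl⟩ := (of p f R).surjective x
  have hpow : z ^ (p ^ f - 1) * t * z = z ^ p ^ f • t := by
    rw [mul_right_comm, pow_sub_one_mul (pow_ne_zero f (expChar_pos R p).ne'), smul_eq_mul]
  have hzero := h (z ^ (p ^ f - 1) * t)
  rw [hpow, ← smul_of, map_smul] at hzero
  exact (smul_eq_zero.1 hzero).resolve_left hz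

-- Over the fraction field `K` a nonzero `φ` generates the one-dimensional `F^f_* K`-space
-- `Hom_K(F^f_* K, K)`, so its multiples `φ(x_i · -)` by a basis `x_i` form a basis of the dual.
theorem exists_dual_frame (hF : (frobenius R p).Finite) {f : ℕ}
    {φ : FrobPush p f R →ₗ[R] R} (hφ : φ ≠ 0) :
    ∃ (c : R) (h : FrobPush p f R →ₗ[R] (Fin (Module.finrank R (FrobPush p f R)) → R)),
      c ≠ 0 ∧ (∀ v, c • v ∈ LinearMap.range h) ∧
      ∀ i, ∃ a : R, ∀ r, h (of p f R r) i = φ (of p f R (a * r)) := by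
  have := finite f (M := R) hF
  obtain ⟨c, hc, g, g', hgg', -⟩ := exists_quasiInverse R (FrobPush p f R)
  let x (i) : R := (of p f R).symm (g (Pi.single i 1))
  let h : FrobPush p f R →ₗ[R] (Fin (Module.finrank R (FrobPush p f R)) → R) :=
    LinearMap.pi fun i => φ ∘ₗ map f (LinearMap.mulLeft R (x i))
  have hinj : Function.Injective h := by
    rw [injective_iff_map_eq_zero]
    intro z hz
    by_contra hz0
    let ψ : FrobPush p f R →ₗ[R] R := φ ∘ₗ map f (LinearMap.mulRight R ((of p f R).symm z))
    have hψg : ψ ∘ₗ g = 0 :=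
      LinearMap.pi_ext' fun i => LinearMap.ext_ring (congrFun hz i)
    have hψ (y : FrobPush p f R) : c • ψ y = 0 := by
      rw [← map_smul, ← hgg', ← LinearMap.comp_apply, hψg, LinearMap.zero_apply]
    exact hφ (eq_zero_of_forall_mul hz0 fun y =>
      (smul_eq_zero.1 (hψ (of p f R y))).resolve_left hc)
  obtain ⟨c', hc', hrange⟩ := exists_ne_zero_smul_mem_range hinj (Module.finrank_fin_fun R).le
  exact ⟨c', h, hc', hrange, fun i => ⟨x i, fun r => rfl⟩⟩

end

end FrobPush

section FrobeniusPower

variable {R : Type*} [CommRing R] (p : ℕ) [ExpChar R p]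

/-- The Frobenius power `I^{[p^e]}` of an ideal, generated by the `p^e`-th powers of its
elements. -/
def frobeniusPower (e : ℕ) (I : Ideal R) : Ideal R := I.map (iterateFrobenius R p e)

variable {p} {e : ℕ} {I : Ideal R}

theorem pow_mem_frobeniusPower {x : R} (hx : x ∈ I) : x ^ p ^ e ∈ frobeniusPower p e I :=
  Ideal.mem_map_of_mem (iterateFrobenius R p e) hx

theorem frobeniusPower_le {J : Ideal R} : frobeniusPower p e I ≤ J ↔ ∀ x ∈ I, x ^ p ^ e ∈ J :=
  Ideal.map_le_iff_le_comap

theorem frobeniusPower_le_pow : frobeniusPower p e I ≤ I ^ p ^ e :=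
  frobeniusPower_le.2 fun _ hx => Ideal.pow_mem_pow hx _

theorem pow_mem_frobeniusPower_add {f : ℕ} {x : R} (hx : x ∈ frobeniusPower p e I) :
    x ^ p ^ f ∈ frobeniusPower p (e + f) I := by
  suffices h : frobeniusPower p e I ≤ (frobeniusPower p (e + f) I).comap (iterateFrobenius R p f)
    from h hx
  refine frobeniusPower_le.2 fun x hx => ?_
  rw [Ideal.mem_comap, iterateFrobenius_def, ← pow_mul, ← pow_add]
  exact pow_mem_frobeniusPower hx

theorem frobeniusPower_smul_top_le_submodule (f : ℕ) :
    frobeniusPower p e I • (⊤ : Submodule R (FrobPush p f R)) ≤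
      FrobPush.submodule f (frobeniusPower p (e + f) I) := by
  rw [Submodule.smul_le]
  intro r hr x _
  rw [FrobPush.smul_eq, FrobPush.mem_submodule]
  exact Ideal.mul_mem_right _ _ (pow_mem_frobeniusPower_add hr)

end FrobeniusPower

section HilbertKunz

open IsLocalRing

variable {R : Type*} [CommRing R] [IsLocalRing R] [IsNoetherianRing R] (p : ℕ) [Fact p.Prime]
  [CharP R p]

theorem exists_length_quotient_ker_sup_frobeniusPower_le {S : Type*} [CommRing S]
    [IsNoetherianRing S] [IsLocalRing S] {f : R →+* S} (hf : Function.Surjective f) :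
    ∃ K : ℕ, ∀ e : ℕ,
      Module.length R (R ⧸ RingHom.ker f ⊔ frobeniusPower p e (maximalIdeal R)) ≤
        K * ((p : ℕ∞) ^ e) ^ localDim S := by
  obtain ⟨s, hcard, hs, hfin⟩ := exists_parameters_of_surjective hf
  refine ⟨(Module.length R (R ⧸ RingHom.ker f ⊔ Ideal.span (s : Set R))).toNat, fun e => ?_⟩
  have hpowers : Ideal.span ((· ^ p ^ e) '' (s : Set R)) ≤ frobeniusPower p e (maximalIdeal R) := by
    rw [Ideal.span_le, Set.image_subset_iff]
    exact fun x hx => pow_mem_frobeniusPower (hs hx)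
  calc Module.length R (R ⧸ RingHom.ker f ⊔ frobeniusPower p e (maximalIdeal R))
      ≤ Module.length R (R ⧸ RingHom.ker f ⊔ Ideal.span ((· ^ p ^ e) '' (s : Set R))) :=
        length_quotient_le_of_le (sup_le_sup_left hpowers _)
    _ ≤ ((p ^ e : ℕ) : ℕ∞) ^ s.card * Module.length R (R ⧸ RingHom.ker f ⊔ Ideal.span s) :=
        length_quotient_sup_span_image_pow_le s (p ^ e) _
    _ ≤ _ := by
        rw [ENat.natCast_toNat hfin, mul_comm, ← Nat.cast_pow p e]
        gcongr
        exact_mod_cast Nat.one_le_pow e p (Fact.out : p.Prime).pos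

variable (R) in
theorem exists_length_quotient_frobeniusPower_le : ∃ K : ℕ, ∀ e : ℕ,
    Module.length R (R ⧸ frobeniusPower p e (maximalIdeal R)) ≤
      K * ((p : ℕ∞) ^ e) ^ localDim R := by
  have hker : RingHom.ker (RingHom.id R) = ⊥ :=
    (RingHom.injective_iff_ker_eq_bot _).1 Function.injective_id
  obtain ⟨K, hK⟩ := exists_length_quotient_ker_sup_frobeniusPower_le p
    (f := RingHom.id R) Function.surjective_id
  exact ⟨K, fun e => (length_quotient_le_of_le (sup_le (hker.trans_le bot_le) le_rfl)).trans (hK e)⟩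

theorem length_quotient_frobeniusPower_ne_top (e : ℕ) :
    Module.length R (R ⧸ frobeniusPower p e (maximalIdeal R)) ≠ ⊤ := by
  obtain ⟨K, hK⟩ := exists_length_quotient_frobeniusPower_le R p
  refine ne_top_of_le_ne_top ?_ (hK e)
  exact_mod_cast ENat.natCast_ne_top (K * (p ^ e) ^ localDim R)

variable {p}

theorem length_quotient_ne_top_of_frobeniusPower_le {I : Ideal R} {e : ℕ}
    (h : frobeniusPower p e (maximalIdeal R) ≤ I) : Module.length R (R ⧸ I) ≠ ⊤ :=
  ne_top_of_le_ne_top (length_quotient_frobeniusPower_ne_top p e) (length_quotient_le_of_le h)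

theorem length_quotient_ne_top_of_frobeniusPower_smul_top_le {M : Type*} [AddCommGroup M]
    [Module R M] [Module.Finite R M] {S : Submodule R M} {e : ℕ}
    (h : frobeniusPower p e (maximalIdeal R) • ⊤ ≤ S) : Module.length R (M ⧸ S) ≠ ⊤ := by
  obtain ⟨r, hr⟩ := exists_length_quotient_smul_top_le R M
  exact ne_top_of_le_ne_top
    (WithTop.mul_ne_top (ENat.natCast_ne_top r) (length_quotient_frobeniusPower_ne_top p e))
    ((length_quotient_le_of_le h).trans (hr _))

variable (R p) in
theorem exists_localDim_pow_le_length_quotient_frobeniusPower : ∃ s : ℕ, ∀ e : ℕ,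
    ((p : ℕ∞) ^ e) ^ localDim R ≤
      Module.length R (R ⧸ frobeniusPower p (e + s) (maximalIdeal R)) := by
  obtain ⟨b, hb⟩ := exists_localDim_pow_le_length_quotient_pow R
  have hp : p.Prime := Fact.out
  refine ⟨b, fun e => ?_⟩
  rw [← Nat.cast_pow p e]
  refine (hb (p ^ e) (Nat.one_le_pow e p hp.pos)).trans (length_quotient_le_of_le
    (frobeniusPower_le_pow.trans (Ideal.pow_le_pow_right ?_)))
  rw [pow_add, mul_comm]
  exact Nat.mul_le_mul_left _ (Nat.lt_pow_self hp.one_lt).le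

theorem localDim_quotient_span_singleton_add_one_le [IsDomain R] {c : R} (hc : c ≠ 0)
    [IsLocalRing (R ⧸ Ideal.span {c})] :
    localDim (R ⧸ Ideal.span {c}) + 1 ≤ localDim R := by
  have h := ringKrullDim_quotient_succ_le_of_nonZeroDivisor (mem_nonZeroDivisors_of_ne_zero hc)
  rw [← coe_localDim, ← coe_localDim] at h
  exact_mod_cast h

theorem exists_length_quotient_span_singleton_sup_le [IsDomain R] {c : R} (hc : c ≠ 0) :
    ∃ K : ℕ, ∀ e : ℕ, (p : ℕ∞) ^ e *
        Module.length R (R ⧸ Ideal.span {c} ⊔ frobeniusPower p e (maximalIdeal R)) ≤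
      K * ((p : ℕ∞) ^ e) ^ localDim R := by
  rcases subsingleton_or_nontrivial (R ⧸ Ideal.span {c}) with hunit | hnontrivial
  · refine ⟨0, fun e => ?_⟩
    rw [Ideal.Quotient.subsingleton_iff.1 hunit, top_sup_eq, Module.length_eq_zero_iff.2
      (Ideal.Quotient.subsingleton_iff.2 rfl), mul_zero]
    exact zero_le
  have hsurj := Ideal.Quotient.mk_surjective (I := Ideal.span {c})
  have := IsLocalRing.of_surjective' _ hsurj
  obtain ⟨K, hK⟩ := exists_length_quotient_ker_sup_frobeniusPower_le p hsurj
  rw [Ideal.mk_ker] at hK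
  refine ⟨K, fun e => (mul_le_mul_right (hK e) _).trans ?_⟩
  rw [mul_left_comm, ← pow_succ']
  refine mul_le_mul_right (pow_le_pow_right₀ ?_
    (localDim_quotient_span_singleton_add_one_le hc)) _
  exact_mod_cast Nat.one_le_pow e p (Fact.out : p.Prime).pos

end HilbertKunz

section NormalizedLength

open IsLocalRing

variable (R : Type*) [CommRing R] (p : ℕ)

/-- The length of `N` in units of `q ^ dim R`, where `q = p ^ e`; an infinite length counts
as `0`. -/
def normalizedLength (e : ℕ) (N : Type*) [AddCommGroup N] [Module R N] : ℝ :=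
  ((Module.length R N).toNat : ℝ) / ((p : ℝ) ^ e) ^ localDim R

theorem normalizedLength_nonneg (e : ℕ) (N : Type*) [AddCommGroup N] [Module R N] :
    0 ≤ normalizedLength R p e N := by
  unfold normalizedLength
  positivity

variable {R p}

theorem mul_normalizedLength_le_of_mul_length_le {e k a b : ℕ} {N N₁ N₂ : Type*} [AddCommGroup N]
    [Module R N] [AddCommGroup N₁] [Module R N₁] [AddCommGroup N₂] [Module R N₂]
    (h₁ : Module.length R N₁ ≠ ⊤) (h₂ : Module.length R N₂ ≠ ⊤)
    (h : k * Module.length R N ≤ a * Module.length R N₁ + b * Module.length R N₂) :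
    k * normalizedLength R p e N ≤
      a * normalizedLength R p e N₁ + b * normalizedLength R p e N₂ := by
  simp only [normalizedLength, ← mul_div_assoc, ← add_div]
  gcongr
  obtain ⟨n₁, hn₁⟩ := ENat.ne_top_iff_exists.1 h₁
  obtain ⟨n₂, hn₂⟩ := ENat.ne_top_iff_exists.1 h₂
  rw [← hn₁, ← hn₂] at h ⊢
  have htoNat := ENat.toNat_le_toNat h (by exact_mod_cast ENat.natCast_ne_top (a * n₁ + b * n₂))
  rw [ENat.toNat_mul] at htoNat
  exact_mod_cast htoNat

theorem rpow_deltaExp [IsLocalRing R] [Fact p.Prime] [CharP R p]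
    (hF : (frobenius R p).Finite) (e : ℕ) :
    ((p : ℝ) ^ e) ^ deltaExp R p =
      (FrobPush.residueDegree R p : ℝ) ^ e * ((p : ℝ) ^ e) ^ localDim R := by
  have hp : 1 < (p : ℝ) := Nat.one_lt_cast.2 (Fact.out : p.Prime).one_lt
  have hp₀ : 0 < (p : ℝ) := zero_lt_one.trans hp
  have hdegree : 0 < (FrobPush.residueDegree R p : ℝ) :=
    Nat.cast_pos.2 (FrobPush.residueDegree_pos hF)
  rw [deltaExp, Real.rpow_add (pow_pos hp₀ e), Real.rpow_natCast, mul_comm]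
  congr 1
  rw [← Real.rpow_pow_comm hp₀.le]
  exact congrArg (· ^ e) (Real.rpow_logb hp₀ hp.ne' hdegree)

theorem normalizedLength_frobPush_quotient [IsLocalRing R] [Fact p.Prime] [CharP R p]
    (hF : (frobenius R p).Finite) (e f : ℕ) {M : Type*} [AddCommGroup M] [Module R M]
    (S : Submodule R M) :
    normalizedLength R p e (FrobPush p f M ⧸ FrobPush.submodule (p := p) f S) =
      ((p : ℝ) ^ f) ^ deltaExp R p * normalizedLength R p (e + f) (M ⧸ S) := by
  have hp : (p : ℝ) ≠ 0 := Nat.cast_ne_zero.2 (Fact.out : p.Prime).ne_zero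
  rw [rpow_deltaExp hF, normalizedLength, normalizedLength, FrobPush.length_quotient_submodule hF,
    ENat.toNat_mul, ← Nat.cast_pow, ENat.toNat_natCast, pow_add, mul_pow]
  push_cast
  field_simp

end NormalizedLength

section Estimates

open IsLocalRing

variable {R : Type*} [CommRing R] [IsLocalRing R] [IsNoetherianRing R] {p : ℕ} [Fact p.Prime]
  [CharP R p]

variable (R p) in
theorem exists_normalizedLength_quotient_frobeniusPower_le : ∃ B : ℝ, ∀ (e : ℕ) (I : Ideal R),
    frobeniusPower p e (maximalIdeal R) ≤ I → normalizedLength R p e (R ⧸ I) ≤ B := by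
  obtain ⟨K, hK⟩ := exists_length_quotient_frobeniusPower_le R p
  have hp : 0 < p := (Fact.out : p.Prime).pos
  refine ⟨K, fun e I hI => (div_le_iff₀ (by positivity)).2 ?_⟩
  have htoNat := ENat.toNat_le_toNat ((length_quotient_le_of_le hI).trans (hK e))
    (by exact_mod_cast ENat.natCast_ne_top (K * (p ^ e) ^ localDim R))
  exact_mod_cast htoNat

variable (R p) in
theorem exists_pos_le_normalizedLength_quotient_frobeniusPower : ∃ δ : ℝ, 0 < δ ∧
    ∀ᶠ e in atTop, δ ≤ normalizedLength R p e (R ⧸ frobeniusPower p e (maximalIdeal R)) := by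
  obtain ⟨s, hs⟩ := exists_localDim_pow_le_length_quotient_frobeniusPower R p
  have hp : 0 < p := (Fact.out : p.Prime).pos
  refine ⟨(((p : ℝ) ^ s) ^ localDim R)⁻¹, by positivity, ?_⟩
  filter_upwards [eventually_ge_atTop s] with e' he'
  obtain ⟨e, rfl⟩ := Nat.exists_eq_add_of_le' he'
  have hlength : ((p : ℝ) ^ e) ^ localDim R ≤
      (Module.length R (R ⧸ frobeniusPower p (e + s) (maximalIdeal R))).toNat := by
    have htoNat := ENat.toNat_le_toNat (hs e) (length_quotient_frobeniusPower_ne_top p _)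
    exact_mod_cast htoNat
  rw [normalizedLength, le_div_iff₀ (by positivity), pow_add, mul_pow, mul_comm, mul_assoc,
    mul_inv_cancel₀ (by positivity), mul_one]
  exact hlength

variable [IsDomain R]

variable (p) in
theorem exists_normalizedLength_quotient_span_singleton_sup_le {c : R} (hc : c ≠ 0) :
    ∃ K : ℝ, ∀ (e : ℕ) (I : Ideal R), frobeniusPower p e (maximalIdeal R) ≤ I →
      normalizedLength R p e (R ⧸ Ideal.span {c} ⊔ I) ≤ K * (p : ℝ)⁻¹ ^ e := by
  obtain ⟨K, hK⟩ := exists_length_quotient_span_singleton_sup_le (p := p) hc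
  have hp : 0 < p := (Fact.out : p.Prime).pos
  refine ⟨K, fun e I hI => ?_⟩
  have htoNat := ENat.toNat_le_toNat ((mul_le_mul_right
    (length_quotient_le_of_le (sup_le_sup_left hI _)) _).trans (hK e))
    (by exact_mod_cast ENat.natCast_ne_top (K * (p ^ e) ^ localDim R))
  rw [ENat.toNat_mul] at htoNat
  rw [normalizedLength, div_le_iff₀ (by positivity), inv_pow, mul_right_comm,
    ← div_eq_mul_inv, le_div_iff₀ (by positivity), mul_comm]
  exact_mod_cast htoNat

variable (R p) in
theorem exists_normalizedLength_quotient_le (M : Type*) [AddCommGroup M] [Module R M]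
    [Module.Finite R M] :
    ∃ K : ℝ, ∀ (e : ℕ) (I : Ideal R) (S : Submodule R M),
      frobeniusPower p e (maximalIdeal R) ≤ I → I • ⊤ ≤ S →
      normalizedLength R p e (M ⧸ S) ≤
        Module.finrank R M * normalizedLength R p e (R ⧸ I) + K * (p : ℝ)⁻¹ ^ e := by
  obtain ⟨c, r, hc, hlength⟩ := exists_length_quotient_le_finrank_mul R M
  obtain ⟨K, hK⟩ := exists_normalizedLength_quotient_span_singleton_sup_le p hc
  refine ⟨r * K, fun e I S hI hS => ?_⟩
  calc normalizedLength R p e (M ⧸ S)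
      = (1 : ℕ) * normalizedLength R p e (M ⧸ S) := by rw [Nat.cast_one, one_mul]
    _ ≤ Module.finrank R M * normalizedLength R p e (R ⧸ I) +
          r * normalizedLength R p e (R ⧸ Ideal.span {c} ⊔ I) :=
        mul_normalizedLength_le_of_mul_length_le (length_quotient_ne_top_of_frobeniusPower_le hI)
          (length_quotient_ne_top_of_frobeniusPower_le (hI.trans le_sup_right))
          (by rw [Nat.cast_one, one_mul]; exact hlength I S hS)
    _ ≤ _ := by
        rw [mul_assoc]
        gcongr
        exact hK e I hI

variable (p) in
theorem exists_card_mul_normalizedLength_le {ι M : Type*} [Fintype ι] [AddCommGroup M]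
    [Module R M] [Module.Finite R M] (h : M →ₗ[R] (ι → R)) {c : R} (hc : c ≠ 0)
    (hrange : ∀ v, c • v ∈ LinearMap.range h) :
    ∃ K : ℝ, ∀ (e : ℕ) (I : Ideal R) (S : Submodule R M),
      frobeniusPower p e (maximalIdeal R) ≤ I →
      frobeniusPower p e (maximalIdeal R) • ⊤ ≤ S → (∀ x ∈ S, ∀ i, h x i ∈ I) →
      Fintype.card ι * normalizedLength R p e (R ⧸ I) ≤
        normalizedLength R p e (M ⧸ S) + K * (p : ℝ)⁻¹ ^ e := by
  obtain ⟨r, hr⟩ := exists_card_mul_length_quotient_le h hrange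
  obtain ⟨K, hK⟩ := exists_normalizedLength_quotient_span_singleton_sup_le p hc
  refine ⟨r * K, fun e I S hI hfin hS => ?_⟩
  calc Fintype.card ι * normalizedLength R p e (R ⧸ I)
      ≤ (1 : ℕ) * normalizedLength R p e (M ⧸ S) +
          r * normalizedLength R p e (R ⧸ Ideal.span {c} ⊔ I) :=
        mul_normalizedLength_le_of_mul_length_le
          (length_quotient_ne_top_of_frobeniusPower_smul_top_le hfin)
          (length_quotient_ne_top_of_frobeniusPower_le (hI.trans le_sup_right))
          (by rw [Nat.cast_one, one_mul]; exact hr I S hS)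
    _ ≤ _ := by
        rw [Nat.cast_one, one_mul, mul_assoc]
        gcongr
        exact hK e I hI

end Estimates

section Sequences

theorem tendsto_zero_of_le_mul_add {u ε : ℕ → ℝ} {t : ℝ} (ht₀ : 0 ≤ t) (ht₁ : t < 1)
    (hu₀ : ∀ j, 0 ≤ u j) (hε : Tendsto ε atTop (𝓝 0)) (hu : ∀ j, u (j + 1) ≤ t * u j + ε j) :
    Tendsto u atTop (𝓝 0) := by
  refine tendsto_order.2 ⟨fun a ha => .of_forall fun j => ha.trans_le (hu₀ j), fun a ha => ?_⟩
  obtain ⟨j₀, hj₀⟩ := eventually_atTop.1 (hε.eventually_le_const (u := (1 - t) * (a / 2))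
    (mul_pos (sub_pos.2 ht₁) (half_pos ha)))
  have hcontract (i : ℕ) : u (j₀ + i) - a / 2 ≤ t ^ i * (u j₀ - a / 2) := by
    induction i with
    | zero => simp only [add_zero, pow_zero, one_mul, le_refl]
    | succ i ih =>
      have hscaled := mul_le_mul_of_nonneg_left ih ht₀
      rw [← add_assoc, pow_succ', mul_assoc]
      linarith [hu (j₀ + i), hj₀ (j₀ + i) (Nat.le_add_right _ _)]
  have hlim : Tendsto (fun i => t ^ i * (u j₀ - a / 2)) atTop (𝓝 0) := by
    simpa only [zero_mul] using (tendsto_pow_atTop_nhds_zero_of_lt_one ht₀ ht₁).mul_const _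
  obtain ⟨i₀, hi₀⟩ := eventually_atTop.1 (hlim.eventually_lt_const (half_pos ha))
  filter_upwards [eventually_ge_atTop (j₀ + i₀)] with j hj
  obtain ⟨i, rfl⟩ := Nat.exists_eq_add_of_le ((Nat.le_add_right _ _).trans hj)
  linarith [hcontract i, hi₀ i (Nat.add_le_add_iff_left.1 hj)]

theorem tendsto_const_mul_pow_mul_zero {ρ : ℝ} (hρ₀ : 0 ≤ ρ) (hρ₁ : ρ < 1) (K : ℝ) {n : ℕ}
    (hn : n ≠ 0) : Tendsto (fun j => K * ρ ^ (j * n)) atTop (𝓝 0) := by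
  simpa only [mul_comm _ n, pow_mul, mul_zero] using
    (tendsto_pow_atTop_nhds_zero_of_lt_one (pow_nonneg hρ₀ n) (pow_lt_one₀ hρ₀ hρ₁ hn)).const_mul K

theorem exists_tendsto_of_le_add {w : ℕ → ℝ} (hw : BddAbove (Set.range w)) {N : ℕ}
    (h : ∀ s ≥ N, ∀ j, w j ≤ w (j + s)) : ∃ r, Tendsto w atTop (𝓝 r) := by
  refine ⟨⨆ j, w j, tendsto_order.2 ⟨fun a ha => ?_, fun a ha => ?_⟩⟩
  · obtain ⟨j, hj⟩ := exists_lt_of_lt_ciSup ha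
    filter_upwards [eventually_ge_atTop (j + N)] with i hi
    obtain ⟨s, rfl⟩ := Nat.exists_eq_add_of_le ((Nat.le_add_right _ _).trans hi)
    exact hj.trans_le (h s (Nat.add_le_add_iff_left.1 hi) j)
  · exact .of_forall fun j => (le_ciSup hw j).trans_lt ha

variable {u : ℕ → ℝ} {ρ : ℝ} {Γ : AddSubmonoid ℕ}

-- The errors `K * ρ ^ e` telescope, and finitely many generators of `Γ` have a common `K`.
theorem exists_sub_mul_pow_le_of_le_add (hρ₀ : 0 ≤ ρ) (hρ₁ : ρ < 1)
    (hu : ∀ f ∈ Γ, ∃ K, ∀ e, u e ≤ u (e + f) + K * ρ ^ e) :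
    ∃ L, 0 ≤ L ∧ ∀ f ∈ Γ, ∀ e, u e - L * ρ ^ e ≤ u (e + f) - L * ρ ^ (e + f) := by
  obtain ⟨T, rfl⟩ := Nat.addSubmonoid_fg Γ
  choose! K hK using hu
  have hρ : 0 < 1 - ρ := sub_pos.2 hρ₁
  let L := (∑ f ∈ T, |K f|) / (1 - ρ)
  have hL : 0 ≤ L := by positivity
  refine ⟨L, hL, fun f hf => ?_⟩
  induction hf using AddSubmonoid.closure_induction with
  | zero => exact fun e => le_rfl
  | add f g _ _ hf hg => exact fun e => (hf e).trans (add_assoc e f g ▸ hg (e + f))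
  | mem f hf =>
    intro e
    rcases eq_or_ne f 0 with rfl | hf₀
    · exact le_rfl
    have hKL : K f ≤ L * (1 - ρ) := by
      rw [div_mul_cancel₀ _ hρ.ne']
      exact (le_abs_self _).trans
        (Finset.single_le_sum (f := fun f => |K f|) (fun _ _ => abs_nonneg _) hf)
    have hpow : ρ ^ f ≤ ρ := pow_le_of_le_one hρ₀ hρ₁.le hf₀
    have herror : K f * ρ ^ e ≤ L * (1 - ρ ^ f) * ρ ^ e := by
      gcongr
      exact hKL.trans (by gcongr)
    rw [pow_add]
    linarith [hK f (AddSubmonoid.subset_closure hf) e]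

theorem exists_tendsto_mul_setGcd (hbdd : BddAbove (Set.range u)) (hρ₀ : 0 ≤ ρ) (hρ₁ : ρ < 1)
    (hu : ∀ f ∈ Γ, ∃ K, ∀ e, u e ≤ u (e + f) + K * ρ ^ e) :
    ∃ r, Tendsto (fun j => u (j * Nat.setGcd (Γ : Set ℕ))) atTop (𝓝 r) := by
  set n := Nat.setGcd (Γ : Set ℕ)
  rcases eq_or_ne n 0 with hn | hn
  · exact ⟨u 0, by simp only [hn, mul_zero, tendsto_const_nhds]⟩
  obtain ⟨L, hL, hmono⟩ := exists_sub_mul_pow_le_of_le_add hρ₀ hρ₁ hu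
  obtain ⟨B, hB⟩ := hbdd
  obtain ⟨N, hN⟩ := Nat.exists_mem_closure_of_ge (Γ : Set ℕ)
  rw [AddSubmonoid.closure_eq] at hN
  have hmul : ∀ j, j ≤ j * n := fun j => Nat.le_mul_of_pos_right j (Nat.pos_of_ne_zero hn)
  obtain ⟨r, hr⟩ := exists_tendsto_of_le_add (w := fun j => u (j * n) - L * ρ ^ (j * n)) (N := N)
    ⟨B, by
      rintro _ ⟨j, rfl⟩
      exact (sub_le_self _ (by positivity)).trans (hB ⟨_, rfl⟩)⟩
    (fun s hs j => add_mul j s n ▸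
      hmono _ (hN _ (hs.le.trans (hmul s)) (dvd_mul_left n s)) (j * n))
  exact ⟨r + 0, by
    simpa only [sub_add_cancel] using hr.add (tendsto_const_mul_pow_mul_zero hρ₀ hρ₁ L hn)⟩

end Sequences

section Rank

open IsLocalRing

variable {R : Type*} [CommRing R] [IsLocalRing R] [IsNoetherianRing R] [IsDomain R] {p : ℕ}
  [Fact p.Prime] [CharP R p]

theorem exists_normalizedLength_frobeniusPower_add_le (hF : (frobenius R p).Finite) (f : ℕ) :
    ∃ K : ℝ, ∀ e,
      ((p : ℝ) ^ f) ^ deltaExp R p *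
          normalizedLength R p (e + f) (R ⧸ frobeniusPower p (e + f) (maximalIdeal R)) ≤
        Module.finrank R (FrobPush p f R) *
          normalizedLength R p e (R ⧸ frobeniusPower p e (maximalIdeal R)) +
            K * (p : ℝ)⁻¹ ^ e := by
  have := FrobPush.finite f (M := R) hF
  obtain ⟨K, hK⟩ := exists_normalizedLength_quotient_le R p (FrobPush p f R)
  refine ⟨K, fun e => ?_⟩
  rw [← normalizedLength_frobPush_quotient hF]
  exact hK e _ _ le_rfl (frobeniusPower_smul_top_le_submodule f)

-- If the rank were smaller, the normalized lengths of `R / 𝔪^{[p^e]}` would be contracted to `0`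
-- along the multiples of `f`, whereas they are bounded below.
theorem rpow_deltaExp_le_finrank_frobPush (hF : (frobenius R p).Finite) (f : ℕ) :
    ((p : ℝ) ^ f) ^ deltaExp R p ≤ Module.finrank R (FrobPush p f R) := by
  rcases eq_or_ne f 0 with rfl | hf
  · simp only [pow_zero, Real.one_rpow, FrobPush.zeroEquiv.finrank_eq, Module.finrank_self,
      Nat.cast_one, le_refl]
  by_contra! hlt
  have hp : 1 < p := (Fact.out : p.Prime).one_lt
  have hρ : (p : ℝ)⁻¹ < 1 := inv_lt_one_of_one_lt₀ (Nat.one_lt_cast.2 hp)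
  obtain ⟨K, hK⟩ := exists_normalizedLength_frobeniusPower_add_le hF f
  set D := ((p : ℝ) ^ f) ^ deltaExp R p
  have hD : 0 < D := (Nat.cast_nonneg _).trans_lt hlt
  let u (e : ℕ) := normalizedLength R p e (R ⧸ frobeniusPower p e (maximalIdeal R))
  have herror : Tendsto (fun j => K * (p : ℝ)⁻¹ ^ (j * f) / D) atTop (𝓝 0) := by
    simpa only [zero_div] using
      (tendsto_const_mul_pow_mul_zero (by positivity) hρ K hf).div_const D
  have hlim : Tendsto (fun j => u (j * f)) atTop (𝓝 0) :=
    tendsto_zero_of_le_mul_add (t := Module.finrank R (FrobPush p f R) / D) (by positivity)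
      ((div_lt_one hD).2 hlt) (fun _ => normalizedLength_nonneg _ _ _ _) herror fun j => by
        rw [add_one_mul, div_mul_eq_mul_div, ← add_div, le_div_iff₀' hD]
        exact hK (j * f)
  obtain ⟨δ, hδ, hlower⟩ := exists_pos_le_normalizedLength_quotient_frobeniusPower R p
  have hmul : Tendsto (fun j => j * f) atTop atTop :=
    tendsto_id.atTop_mul_const' (Nat.pos_of_ne_zero hf)
  exact hδ.not_ge (ge_of_tendsto hlim (hmul.eventually hlower))

end Rank

section Splitting

open IsLocalRing

variable {R : Type*} [CommRing R] [IsLocalRing R] {p : ℕ} [Fact p.Prime] [CharP R p]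

namespace FlatSubmodule

variable {C : CartierSubalgebra R p} {M : Type*} [AddCommGroup M] [Module R M]
  (𝓜 : FlatSubmodule C M)

/-- The normalized splitting number `a_e / q ^ δ`, `q = p ^ e`, of an arbitrary degree `e`. -/
def splittingDensity (e : ℕ) : ℝ :=
  ((𝓜.splittingNumber e).toNat : ℝ) / ((p : ℝ) ^ e) ^ deltaExp R p

theorem period_ne_zero {e : ℕ} (he : e ≠ 0) (h : 𝓜.splittingNumber e ≠ 0) : 𝓜.period ≠ 0 :=
  fun hperiod => he (Nat.setGcd_eq_zero_iff.1 hperiod h)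

theorem splittingRatio_eq_zero_of_period_eq_zero (h : 𝓜.period = 0) :
    𝓜.SplittingRatioExists ∧ 𝓜.splittingRatio = 0 :=
  ⟨fun hperiod => absurd h hperiod, if_pos h⟩

theorem splittingRatio_eq_of_tendsto {n : ℕ} (hn : n ≠ 0) (hdvd : n ∣ 𝓜.period) {r : ℝ}
    (h : Tendsto (fun j => 𝓜.splittingDensity (j * n)) atTop (𝓝 r)) :
    𝓜.SplittingRatioExists ∧ 𝓜.splittingRatio = r := by
  obtain ⟨t, ht⟩ := hdvd
  by_cases hperiod : 𝓜.period = 0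
  · obtain ⟨hexists, hzero⟩ := 𝓜.splittingRatio_eq_zero_of_period_eq_zero hperiod
    refine ⟨hexists, hzero.trans (tendsto_nhds_unique (tendsto_const_nhds.congr' ?_) h)⟩
    filter_upwards [eventually_ne_atTop 0] with j hj
    have hnumber : 𝓜.splittingNumber (j * n) = 0 := by
      by_contra hne
      exact 𝓜.period_ne_zero (mul_ne_zero hj hn) hne hperiod
    rw [splittingDensity, hnumber, ENat.toNat_zero, Nat.cast_zero, zero_div]
  · have ht₀ : t ≠ 0 := by
      rintro rfl
      exact hperiod ht
    have hseq : Tendsto 𝓜.splittingSeq atTop (𝓝 r) := by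
      refine (h.comp (tendsto_id.atTop_mul_const' (Nat.pos_of_ne_zero ht₀))).congr fun j => ?_
      rw [Function.comp_apply, id_eq, mul_assoc, mul_comm t, ← ht]
      rfl
    exact ⟨fun _ => ⟨r, hseq⟩, (if_neg hperiod).trans hseq.limUnder_eq⟩

variable {𝓜} {e : ℕ} {S : Submodule R M}

theorem splittingNumber_eq (hF : (frobenius R p).Finite)
    (hS : ∀ m, m ∈ S ↔ ∀ ϑ ∈ 𝓜.deg e, ϑ (FrobPush.of p e M m) ∈ maximalIdeal R) :
    𝓜.splittingNumber e = (FrobPush.residueDegree R p : ℕ∞) ^ e * Module.length R (M ⧸ S) := by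
  have hperp : FrobPush.submodule e S = maximalOrthogonal (𝓜.deg e) := by
    ext x
    obtain ⟨m, rfl⟩ := (FrobPush.of p e M).surjective x
    rw [FrobPush.mem_submodule, hS, mem_maximalOrthogonal]
  rw [← FrobPush.length_quotient_submodule hF, hperp]
  exact length_quotient_submoduleOf_eq_length_quotient_maximalOrthogonal _ _ fun _ => Iff.rfl

theorem splittingNumber_ne_zero_iff (hF : (frobenius R p).Finite)
    (hS : ∀ m, m ∈ S ↔ ∀ ϑ ∈ 𝓜.deg e, ϑ (FrobPush.of p e M m) ∈ maximalIdeal R) :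
    𝓜.splittingNumber e ≠ 0 ↔ S ≠ ⊤ := by
  have hdegree : (FrobPush.residueDegree R p : ℕ∞) ^ e ≠ 0 :=
    pow_ne_zero e (Nat.cast_ne_zero.2 (FrobPush.residueDegree_pos hF).ne')
  rw [splittingNumber_eq hF hS, mul_ne_zero_iff, and_iff_right hdegree, Ne,
    Module.length_eq_zero_iff, Submodule.Quotient.subsingleton_iff]

theorem splittingDensity_eq (hF : (frobenius R p).Finite)
    (hS : ∀ m, m ∈ S ↔ ∀ ϑ ∈ 𝓜.deg e, ϑ (FrobPush.of p e M m) ∈ maximalIdeal R) :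
    𝓜.splittingDensity e = normalizedLength R p e (M ⧸ S) := by
  have hdegree : (FrobPush.residueDegree R p : ℝ) ^ e ≠ 0 :=
    pow_ne_zero e (Nat.cast_ne_zero.2 (FrobPush.residueDegree_pos hF).ne')
  rw [splittingDensity, normalizedLength, splittingNumber_eq hF hS, rpow_deltaExp hF,
    ENat.toNat_mul, ← Nat.cast_pow, ENat.toNat_natCast, Nat.cast_mul, Nat.cast_pow,
    mul_div_mul_left _ _ hdegree]

end FlatSubmodule

namespace CartierSubalgebra

variable (C : CartierSubalgebra R p)

/-- The splitting ideal `I_e = {r | φ(F^e_* r) ∈ 𝔪 for all φ ∈ C_e}`. -/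
def splittingIdeal (e : ℕ) : Ideal R where
  carrier := {r | ∀ φ ∈ C.deg e, φ (FrobPush.of p e R r) ∈ maximalIdeal R}
  add_mem' ha hb φ hφ := by rw [map_add, map_add]; exact add_mem (ha φ hφ) (hb φ hφ)
  zero_mem' φ _ := by rw [map_zero, map_zero]; exact zero_mem _
  smul_mem' a r hr φ hφ :=
    hr (FrobPush.comp φ (a • (FrobPush.zeroEquiv (p := p) (R := R) (M := R)).toLinearMap))
      (C.comp_mem (e := 0) hφ (by rw [C.deg_zero]; trivial))

theorem mem_splittingIdeal {e : ℕ} {r : R} : r ∈ C.splittingIdeal e ↔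
    ∀ φ ∈ C.deg e, φ (FrobPush.of p e R r) ∈ maximalIdeal R := Iff.rfl

theorem frobeniusPower_le_splittingIdeal (e : ℕ) :
    frobeniusPower p e (maximalIdeal R) ≤ C.splittingIdeal e := by
  refine frobeniusPower_le.2 fun x hx φ _ => ?_
  rw [← mul_one (x ^ p ^ e), ← smul_eq_mul, ← FrobPush.smul_of, map_smul]
  exact Ideal.mul_mem_right _ _ hx

/-- The degrees in which `C` has a splitting; their `gcd` is the period of `C`. -/
def splittingDegrees : AddSubmonoid ℕ where
  carrier := {e | C.splittingIdeal e ≠ ⊤}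
  zero_mem' := (Ideal.ne_top_iff_one _).2 fun h => (Ideal.ne_top_iff_one _).1
    (maximalIdeal.isMaximal R).ne_top
    (h (FrobPush.zeroEquiv (p := p) (R := R) (M := R)).toLinearMap (by rw [C.deg_zero]; trivial))
  add_mem' {d e} hd he := by
    rw [Set.mem_ofPred_eq, Ideal.ne_top_iff_one, mem_splittingIdeal] at he ⊢
    push Not at he
    obtain ⟨ψ, hψ, hunit⟩ := he
    exact fun h => hd (Ideal.eq_top_of_isUnit_mem _ (fun φ hφ => h _ (C.comp_mem hφ hψ))
      (notMem_maximalIdeal.1 hunit))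

variable {C} in
theorem exists_ne_zero_mem_deg_of_mem_splittingDegrees {f : ℕ} (hf : f ∈ C.splittingDegrees) :
    ∃ φ ∈ C.deg f, φ ≠ 0 := by
  by_contra! hzero
  refine hf ((Ideal.eq_top_iff_one _).2 fun φ hφ => ?_)
  rw [hzero φ hφ, LinearMap.zero_apply]
  exact zero_mem _

theorem setOf_splittingNumber_ne_zero (hF : (frobenius R p).Finite) :
    {e | C.self.splittingNumber e ≠ 0} = C.splittingDegrees :=
  Set.ext fun _ => FlatSubmodule.splittingNumber_ne_zero_iff hF fun _ => C.mem_splittingIdeal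

theorem self_splittingDensity (hF : (frobenius R p).Finite) (e : ℕ) :
    C.self.splittingDensity e = normalizedLength R p e (R ⧸ C.splittingIdeal e) :=
  FlatSubmodule.splittingDensity_eq hF fun _ => C.mem_splittingIdeal

variable (M : Type*) [AddCommGroup M] [Module R M]

/-- The analogue of the splitting ideal for `M^♮`, `{m | ρ(m) ∈ I_e for all ρ ∈ Hom_R(M, R)}`. -/
def splittingSubmodule (e : ℕ) : Submodule R M :=
  ⨅ ρ : M →ₗ[R] R, Submodule.comap ρ (C.splittingIdeal e)

variable {M} in
theorem mem_splittingSubmodule {e : ℕ} {m : M} :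
    m ∈ C.splittingSubmodule M e ↔ ∀ ρ : M →ₗ[R] R, ρ m ∈ C.splittingIdeal e :=
  Submodule.mem_iInf _

variable {M} in
theorem mem_splittingSubmodule_iff_natural {e : ℕ} {m : M} : m ∈ C.splittingSubmodule M e ↔
    ∀ ϑ ∈ (C.natural M).deg e, ϑ (FrobPush.of p e M m) ∈ maximalIdeal R := by
  rw [mem_splittingSubmodule]
  refine ⟨fun hm ϑ hϑ => ?_, fun h ρ φ hφ => h _ (AddSubgroup.subset_closure ⟨φ, hφ, ρ, rfl⟩)⟩
  induction hϑ using AddSubgroup.closure_induction with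
  | mem ϑ hϑ =>
    obtain ⟨φ, hφ, ρ, rfl⟩ := hϑ
    exact hm ρ φ hφ
  | zero => exact zero_mem _
  | add ϑ η _ _ hϑ hη => exact add_mem hϑ hη
  | neg ϑ _ hϑ => exact neg_mem hϑ

theorem splittingIdeal_smul_top_le_splittingSubmodule (e : ℕ) :
    C.splittingIdeal e • ⊤ ≤ C.splittingSubmodule M e := by
  rw [Submodule.smul_le]
  refine fun r hr m _ => C.mem_splittingSubmodule.2 fun ρ => ?_
  rw [map_smul]
  exact Ideal.mul_mem_right _ _ hr

theorem natural_splittingDensity (hF : (frobenius R p).Finite) (e : ℕ) :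
    (C.natural M).splittingDensity e = normalizedLength R p e (M ⧸ C.splittingSubmodule M e) :=
  FlatSubmodule.splittingDensity_eq hF fun _ => C.mem_splittingSubmodule_iff_natural

theorem period_dvd_natural_period (hF : (frobenius R p).Finite) :
    C.self.period ∣ (C.natural M).period := by
  refine Nat.setGcd_mono fun e he => ?_
  rw [setOf_splittingNumber_ne_zero C hF]
  rintro htop : C.splittingIdeal e = ⊤
  refine (FlatSubmodule.splittingNumber_ne_zero_iff hF
    fun _ => C.mem_splittingSubmodule_iff_natural).1 he ?_
  rw [eq_top_iff, ← Submodule.top_smul (⊤ : Submodule R M), ← htop]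
  exact C.splittingIdeal_smul_top_le_splittingSubmodule M e

end CartierSubalgebra

end Splitting

section Convergence

open IsLocalRing

variable {R : Type*} [CommRing R] [IsDomain R] [IsLocalRing R] [IsNoetherianRing R] {p : ℕ}
  [Fact p.Prime] [CharP R p] (C : CartierSubalgebra R p)

namespace CartierSubalgebra

-- A dual frame `r ↦ (φ(F^f_* (a_i r)))_i` maps `F^f_* I_{e+f}` into `I_e ⊕ ⋯ ⊕ I_e`.
theorem exists_self_splittingDensity_le_add (hF : (frobenius R p).Finite) {f : ℕ}
    (hf : f ∈ C.splittingDegrees) : ∃ K : ℝ, ∀ e,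
      C.self.splittingDensity e ≤ C.self.splittingDensity (e + f) + K * (p : ℝ)⁻¹ ^ e := by
  have := FrobPush.finite f (M := R) hF
  obtain ⟨φ, hφ, hφ₀⟩ := exists_ne_zero_mem_deg_of_mem_splittingDegrees hf
  obtain ⟨c, h, hc, hrange, hh⟩ := FrobPush.exists_dual_frame hF hφ₀
  obtain ⟨K, hK⟩ := exists_card_mul_normalizedLength_le p h hc hrange
  have hrank := rpow_deltaExp_le_finrank_frobPush hF f
  set D := ((p : ℝ) ^ f) ^ deltaExp R p with hDdef
  have hD : 0 < D := by
    have hp : 0 < p := (Fact.out : p.Prime).pos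
    positivity
  refine ⟨K / D, fun e => ?_⟩
  have hfin : frobeniusPower p e (maximalIdeal R) • ⊤ ≤
      FrobPush.submodule f (C.splittingIdeal (e + f)) :=
    (frobeniusPower_smul_top_le_submodule f).trans fun x hx =>
      (FrobPush.mem_submodule f).2 (C.frobeniusPower_le_splittingIdeal _
        ((FrobPush.mem_submodule f).1 hx))
  have hmem : ∀ x ∈ FrobPush.submodule f (C.splittingIdeal (e + f)), ∀ i,
      h x i ∈ C.splittingIdeal e := by
    intro x hx i ψ hψ
    obtain ⟨r, rfl⟩ := (FrobPush.of p f R).surjective x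
    obtain ⟨a, ha⟩ := hh i
    rw [ha]
    exact Ideal.mul_mem_left _ a ((FrobPush.mem_submodule f).1 hx) _ (C.comp_mem hψ hφ)
  have hlength := hK e _ _ (C.frobeniusPower_le_splittingIdeal e) hfin hmem
  rw [normalizedLength_frobPush_quotient hF, ← C.self_splittingDensity hF,
    ← C.self_splittingDensity hF, Fintype.card_fin, ← hDdef] at hlength
  refine le_of_mul_le_mul_left ?_ hD
  calc D * C.self.splittingDensity e
      ≤ Module.finrank R (FrobPush p f R) * C.self.splittingDensity e := by
        gcongr
        rw [C.self_splittingDensity hF]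
        exact normalizedLength_nonneg ..
    _ ≤ D * C.self.splittingDensity (e + f) + K * (p : ℝ)⁻¹ ^ e := hlength
    _ = D * (C.self.splittingDensity (e + f) + K / D * (p : ℝ)⁻¹ ^ e) := by field_simp

theorem exists_tendsto_self_splittingDensity (hF : (frobenius R p).Finite) :
    ∃ r, Tendsto (fun j => C.self.splittingDensity (j * C.self.period)) atTop (𝓝 r) := by
  obtain ⟨B, hB⟩ := exists_normalizedLength_quotient_frobeniusPower_le R p
  rw [FlatSubmodule.period, C.setOf_splittingNumber_ne_zero hF]
  refine exists_tendsto_mul_setGcd ⟨B, ?_⟩ (by positivity)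
    (inv_lt_one_of_one_lt₀ (Nat.one_lt_cast.2 (Fact.out : p.Prime).one_lt))
    fun f hf => C.exists_self_splittingDensity_le_add hF hf
  rintro _ ⟨e, rfl⟩
  rw [C.self_splittingDensity hF]
  exact hB e _ (C.frobeniusPower_le_splittingIdeal e)

variable (M : Type*) [AddCommGroup M] [Module R M] [Module.Finite R M]

theorem exists_natural_splittingDensity_le (hF : (frobenius R p).Finite) : ∃ K : ℝ, ∀ e,
    (C.natural M).splittingDensity e ≤
      Module.finrank R M * C.self.splittingDensity e + K * (p : ℝ)⁻¹ ^ e := by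
  obtain ⟨K, hK⟩ := exists_normalizedLength_quotient_le R p M
  refine ⟨K, fun e => ?_⟩
  rw [C.natural_splittingDensity M hF, C.self_splittingDensity hF]
  exact hK e _ _ (C.frobeniusPower_le_splittingIdeal e)
    (C.splittingIdeal_smul_top_le_splittingSubmodule M e)

theorem exists_finrank_mul_self_splittingDensity_le (hF : (frobenius R p).Finite) :
    ∃ K : ℝ, ∀ e, Module.finrank R M * C.self.splittingDensity e ≤
      (C.natural M).splittingDensity e + K * (p : ℝ)⁻¹ ^ e := by
  obtain ⟨c, hc, g, h, -, hhg⟩ := exists_quasiInverse R M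
  obtain ⟨K, hK⟩ := exists_card_mul_normalizedLength_le p h hc fun v => ⟨g v, hhg v⟩
  refine ⟨K, fun e => ?_⟩
  have hfin : frobeniusPower p e (maximalIdeal R) • ⊤ ≤ C.splittingSubmodule M e :=
    (Submodule.smul_mono_left (C.frobeniusPower_le_splittingIdeal e)).trans
      (C.splittingIdeal_smul_top_le_splittingSubmodule M e)
  have hlength := hK e _ _ (C.frobeniusPower_le_splittingIdeal e) hfin
    fun x hx i => C.mem_splittingSubmodule.1 hx (LinearMap.proj i ∘ₗ h)
  rwa [Fintype.card_fin, ← C.natural_splittingDensity M hF, ← C.self_splittingDensity hF]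
    at hlength

theorem tendsto_natural_splittingDensity (hF : (frobenius R p).Finite) {n : ℕ} (hn : n ≠ 0)
    {r : ℝ} (hr : Tendsto (fun j => C.self.splittingDensity (j * n)) atTop (𝓝 r)) :
    Tendsto (fun j => (C.natural M).splittingDensity (j * n)) atTop
      (𝓝 (Module.finrank R M * r)) := by
  obtain ⟨K, hlower⟩ := C.exists_finrank_mul_self_splittingDensity_le M hF
  obtain ⟨L, hupper⟩ := C.exists_natural_splittingDensity_le M hF
  have hp : (p : ℝ)⁻¹ < 1 :=
    inv_lt_one_of_one_lt₀ (Nat.one_lt_cast.2 (Fact.out : p.Prime).one_lt)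
  have herror (K : ℝ) : Tendsto (fun j => K * (p : ℝ)⁻¹ ^ (j * n)) atTop (𝓝 0) :=
    tendsto_const_mul_pow_mul_zero (by positivity) hp K hn
  have hmain := hr.const_mul (Module.finrank R M : ℝ)
  refine tendsto_of_tendsto_of_tendsto_of_le_of_le
    (by simpa only [sub_zero] using hmain.sub (herror K))
    (by simpa only [add_zero] using hmain.add (herror L))
    (fun j => sub_le_iff_le_add.2 (hlower (j * n))) fun j => hupper (j * n)

end CartierSubalgebra

end Convergence

end

theorem mainTheorem4 {R : Type*} [CommRing R] [IsDomain R] [IsLocalRing R]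
    [IsNoetherianRing R] {p : ℕ} [Fact p.Prime] [CharP R p]
    (hF : (frobenius R p).Finite) (C : CartierSubalgebra R p)
    (M : Type*) [AddCommGroup M] [Module R M] [Module.Finite R M] :
    C.self.SplittingRatioExists ∧ (C.natural M).SplittingRatioExists ∧
      (C.natural M).splittingRatio = (Module.finrank R M : ℝ) * C.fSignature := by
  have hdvd : C.self.period ∣ (C.natural M).period := C.period_dvd_natural_period M hF
  rw [CartierSubalgebra.fSignature]
  by_cases hn : C.self.period = 0
  · have hn' : (C.natural M).period = 0 := zero_dvd_iff.1 (hn ▸ hdvd)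
    obtain ⟨hself, hratio⟩ := C.self.splittingRatio_eq_zero_of_period_eq_zero hn
    obtain ⟨hnatural, hratio'⟩ := (C.natural M).splittingRatio_eq_zero_of_period_eq_zero hn'
    exact ⟨hself, hnatural, by rw [hratio, hratio', mul_zero]⟩
  · obtain ⟨r, hr⟩ := C.exists_tendsto_self_splittingDensity hF
    obtain ⟨hself, hratio⟩ := C.self.splittingRatio_eq_of_tendsto hn dvd_rfl hr
    obtain ⟨hnatural, hratio'⟩ := (C.natural M).splittingRatio_eq_of_tendsto hn hdvd
      (C.tendsto_natural_splittingDensity M hF hn hr)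
    exact ⟨hself, hnatural, by rw [hratio, hratio']⟩
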